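/- Let $n\ge 1$. A weight is a non-negative locally integrable function $\omega$ on $\mathbb R^n$. For $1<q<\infty$ say that $\omega\in RH_q$ with constant at most $A$ if $\left(\frac1{|Q|}\int_Q\omega^q\,dx\right)^{1/q}\le A\,\frac1{|Q|}\int_Q\omega\,dx$ for all balls $Q\subset\mathbb R^n$; for $q=\infty$ the left-hand side is replaced by $\operatorname{ess\,sup}_Q\omega$. Let $1<s<\infty$, let $\Theta\subset\mathbb R^n$ be a non-empty finite set of $N$ frequencies, and let $E$ be the complex linear span of the functions $x\mapsto e^{i\xi\cdot x}$, $\xi\in\Theta$. For a ball $Q$ let $3Q$ be the ball with the same center and three times the radius, and for $g\in L^s(3Q)$ let $P_{\Theta,Q}(g)\in E$ be a best approximation of $g$ from $E$ in $L^s(3Q)$, i.e. $\|g-P_{\Theta,Q}(g)\|_{L^s(3Q)}=\inf_{\phi\in E}\|g-\phi\|_{L^s(3Q)}$ (it exists since $\dim E<\infty$). For $f\in L^s(\mathbb R^n)$, complex-valued, define the multi-frequency maximal sharp function $$M^\sharp_{s,\Theta}f(x_0):=\sup_{Q\ni x_0}\left(\frac1{|Q|}\int_Q\left|f-P_{\Theta,Q}(f\mathbf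 1_Q)\right|^s dx\right)^{1/s},$$ the supremum being over all balls $Q$ containing $x_0$. **Proposition.** Let $1<s<\infty$, $1\le t<\infty$, $s\le p<\infty$ and $A\ge 0$, and let $t'=t/(t-1)$ be the conjugate exponent of $t$ ($t'=\infty$ if $t=1$). There is a finite constant $C$, depending only on $n,s,t,p$ and $A$, such that for every weight $\omega\in RH_{t'}$ with constant at most $A$, every non-empty finite set $\Theta\subset\mathbb R^n$ of $N$ frequencies and every $f\in L^s(\mathbb R^n)$, $$\|f\|_{L^p(\omega)}\le C\,N^{\frac{tp}{s}\max\{\frac12,\frac1s\}}\,\left\|M^\sharp_{s,\Theta}f\right\|_{L^p(\omega)},$$ where $\|h\|_{L^p(\omega)}=\left(\int_{\mathbb R^n}|h|^p\,\omega\,dx\right)^{1/p}\in[0,\infty]$; the right-hand side may be infinite, in which case nothing is claimed. -/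

import Mathlib

open MeasureTheory Metric
open scoped ENNReal NNReal

noncomputable section

namespace MultiFreq

/-- The plane wave `x ↦ e^{i ξ·x}` on `ℝⁿ`. -/
def planeWave {n : ℕ} (ξ : EuclideanSpace ℝ (Fin n)) : EuclideanSpace ℝ (Fin n) → ℂ :=
  fun x => Complex.exp (Complex.I * ((inner ℝ ξ x : ℝ) : ℂ))

/-- The finite-dimensional space `E` spanned by the plane waves with frequencies in `Θ`. -/
def expSpan {n : ℕ} (Θ : Finset (EuclideanSpace ℝ (Fin n))) :
    Submodule ℂ (EuclideanSpace ℝ (Fin n) → ℂ) :=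
  Submodule.span ℂ (planeWave '' (Θ : Set (EuclideanSpace ℝ (Fin n))))

/-- `v ∈ E` realizes the `L^s(3Q)`-distance from `g` to `E`, where `Q = B(c, r)`. -/
def IsBestApprox {n : ℕ} (s : ℝ) (Θ : Finset (EuclideanSpace ℝ (Fin n)))
    (c : EuclideanSpace ℝ (Fin n)) (r : ℝ) (g v : EuclideanSpace ℝ (Fin n) → ℂ) : Prop :=
  v ∈ expSpan Θ ∧
    eLpNorm (g - v) (ENNReal.ofReal s) (volume.restrict (ball c (3 * r))) =
      ⨅ φ ∈ expSpan Θ,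
        eLpNorm (g - φ) (ENNReal.ofReal s) (volume.restrict (ball c (3 * r)))

theorem continuous_planeWave {n : ℕ} (ξ : EuclideanSpace ℝ (Fin n)) :
    Continuous (planeWave ξ) := by
  unfold planeWave
  fun_prop

theorem norm_planeWave {n : ℕ} (ξ x : EuclideanSpace ℝ (Fin n)) : ‖planeWave ξ x‖ = 1 := by
  unfold planeWave
  rw [mul_comm]
  exact Complex.norm_exp_ofReal_mul_I _

theorem memLp_of_mem_expSpan {n : ℕ} {Θ : Finset (EuclideanSpace ℝ (Fin n))}
    {φ : EuclideanSpace ℝ (Fin n) → ℂ} (hφ : φ ∈ expSpan Θ) (q : ℝ≥0∞)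
    (μ : Measure (EuclideanSpace ℝ (Fin n))) [IsFiniteMeasure μ] : MemLp φ q μ := by
  unfold expSpan at hφ
  induction hφ using Submodule.span_induction with
  | mem x hx =>
    obtain ⟨ξ, -, rfl⟩ := hx
    exact MemLp.of_bound (continuous_planeWave ξ).aestronglyMeasurable 1
      (Filter.Eventually.of_forall fun x => (norm_planeWave ξ x).le)
  | zero => exact MemLp.zero
  | add x y _ _ hx hy => exact hx.add hy
  | smul a x _ hx => exact hx.const_smul a

theorem exists_closest {V : Type*} [NormedAddCommGroup V] [NormedSpace ℂ V]
    (W : Submodule ℂ V) [FiniteDimensional ℂ W] (g : V) :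
    ∃ w ∈ W, ∀ u ∈ W, ‖g - w‖ ≤ ‖g - u‖ := by
  have : ProperSpace W := FiniteDimensional.proper ℂ W
  have hc : Continuous fun w : W => ‖g - (w : V)‖ := by fun_prop
  have ht : Filter.Tendsto (fun w : W => ‖g - (w : V)‖) (Filter.cocompact W) Filter.atTop := by
    refine Filter.tendsto_atTop_mono (f := fun w : W => ‖w‖ + -‖g‖) (fun w => ?_)
      (Filter.tendsto_atTop_add_const_right _ _ (tendsto_norm_cocompact_atTop (E := W)))
    have := norm_sub_norm_le (w : V) g
    rw [norm_sub_rev] at this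
    simpa [sub_eq_add_neg] using this
  obtain ⟨w, hw⟩ := hc.exists_forall_le ht
  exact ⟨w, w.2, fun u hu => hw ⟨u, hu⟩⟩

/-- Best approximations exist. -/
theorem exists_isBestApprox {n : ℕ} {s : ℝ} (hs : 1 ≤ s)
    (Θ : Finset (EuclideanSpace ℝ (Fin n))) (c : EuclideanSpace ℝ (Fin n)) (r : ℝ)
    {g : EuclideanSpace ℝ (Fin n) → ℂ}
    (hg : MemLp g (ENNReal.ofReal s) (volume.restrict (ball c (3 * r)))) :
    ∃ v, IsBestApprox s Θ c r g v := by
  have : Fact (1 ≤ ENNReal.ofReal s) := ⟨by simpa using hs⟩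
  have : IsFiniteMeasure (volume.restrict (ball c (3 * r))) :=
    isFiniteMeasure_restrict.2 measure_ball_lt_top.ne
  set μ := volume.restrict (ball c (3 * r)) with hμ
  have : FiniteDimensional ℂ (expSpan Θ) :=
    FiniteDimensional.span_of_finite ℂ (Θ.finite_toSet.image _)
  let L : expSpan Θ →ₗ[ℂ] Lp ℂ (ENNReal.ofReal s) μ :=
    { toFun := fun φ => (memLp_of_mem_expSpan φ.2 (ENNReal.ofReal s) μ).toLp φ.1
      map_add' := fun φ ψ => MemLp.toLp_add _ _
      map_smul' := fun a φ => MemLp.toLp_const_smul a _ }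
  obtain ⟨w, ⟨v, rfl⟩, hw⟩ := exists_closest (LinearMap.range L) (hg.toLp g)
  refine ⟨v.1, v.2, le_antisymm (le_iInf₂ fun φ hφ => ?_) (iInf₂_le v.1 v.2)⟩
  have key : ∀ u : expSpan Θ, ‖hg.toLp g - L u‖ₑ = eLpNorm (g - u.1) (ENNReal.ofReal s) μ := by
    intro u
    have : hg.toLp g - L u =
        (hg.sub (memLp_of_mem_expSpan u.2 (ENNReal.ofReal s) μ)).toLp (g - u.1) :=
      (MemLp.toLp_sub hg (memLp_of_mem_expSpan u.2 (ENNReal.ofReal s) μ)).symm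
    rw [this, Lp.enorm_toLp]
  have h := hw (L ⟨φ, hφ⟩) ⟨_, rfl⟩
  rw [← key v, ← key ⟨φ, hφ⟩]
  exact enorm_le_iff_norm_le.2 h

open Classical in
/-- The projection of `g` on `E` in the `L^s(3Q)`-sense, `Q = B(c, r)`: a best approximation
of `g` by elements of `E`, which exists whenever `g ∈ L^s(3Q)` (see `exists_isBestApprox`). -/
def proj {n : ℕ} (s : ℝ) (Θ : Finset (EuclideanSpace ℝ (Fin n)))
    (c : EuclideanSpace ℝ (Fin n)) (r : ℝ) (g : EuclideanSpace ℝ (Fin n) → ℂ) :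
    EuclideanSpace ℝ (Fin n) → ℂ :=
  if h : ∃ v, IsBestApprox s Θ c r g v then h.choose else 0

theorem proj_spec {n : ℕ} {s : ℝ} (hs : 1 ≤ s)
    (Θ : Finset (EuclideanSpace ℝ (Fin n))) (c : EuclideanSpace ℝ (Fin n)) (r : ℝ)
    {g : EuclideanSpace ℝ (Fin n) → ℂ}
    (hg : MemLp g (ENNReal.ofReal s) (volume.restrict (ball c (3 * r)))) :
    IsBestApprox s Θ c r g (proj s Θ c r g) := by
  have h := exists_isBestApprox hs Θ c r hg
  rw [proj, dif_pos h]
  exact h.choose_spec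

/-- The `L^s`-mean `(⨍_Q |h|^s)^{1/s}` over `Q = B(c, r)` (the essential supremum over `Q` if
the exponent is `∞`): the `L^s`-norm for the normalized Lebesgue measure on `Q`. -/
def ballMean {n : ℕ} {F : Type*} [NormedAddCommGroup F] (q : ℝ≥0∞)
    (c : EuclideanSpace ℝ (Fin n)) (r : ℝ) (h : EuclideanSpace ℝ (Fin n) → F) : ℝ≥0∞ :=
  eLpNorm h q ((volume (ball c r))⁻¹ • volume.restrict (ball c r))

/-- The multi-frequency maximal sharp function: the supremum over all balls `Q = B(c, r)`
containing `x` of `(⨍_Q |f - proj_{Θ,Q}(f 1_Q)|^s)^{1/s}`. -/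
def sharpMaximal {n : ℕ} (s : ℝ) (Θ : Finset (EuclideanSpace ℝ (Fin n)))
    (f : EuclideanSpace ℝ (Fin n) → ℂ) (x : EuclideanSpace ℝ (Fin n)) : ℝ≥0∞ :=
  ⨆ (c : EuclideanSpace ℝ (Fin n)) (r : ℝ) (_ : 0 < r) (_ : x ∈ ball c r),
    ballMean (ENNReal.ofReal s) c r (f - proj s Θ c r ((ball c r).indicator f))

/-- A weight: a non-negative locally integrable function. -/
structure IsWeight {n : ℕ} (ω : EuclideanSpace ℝ (Fin n) → ℝ) : Prop where
  nonneg : ∀ x, 0 ≤ ω x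
  locallyIntegrable : LocallyIntegrable ω volume

/-- `ω` is a weight of the reverse Hölder class `RH_q` with constant at most `A`:
`(⨍_Q ω^q)^{1/q} ≤ A ⨍_Q ω` for all balls `Q`; for `q = ∞` the left-hand side is the essential
supremum of `ω` over `Q`. -/
structure ReverseHolder {n : ℕ} (q : ℝ≥0∞) (A : ℝ≥0)
    (ω : EuclideanSpace ℝ (Fin n) → ℝ) : Prop where
  isWeight : IsWeight ω
  le_mean : ∀ (c : EuclideanSpace ℝ (Fin n)) (r : ℝ), 0 < r →
    ballMean q c r ω ≤ A * ENNReal.ofReal (⨍ x in ball c r, ω x)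

/-- The measure `ω dx`. -/
def weightMeasure {n : ℕ} (ω : EuclideanSpace ℝ (Fin n) → ℝ) :
    Measure (EuclideanSpace ℝ (Fin n)) :=
  volume.withDensity fun x => ENNReal.ofReal (ω x)

end MultiFreq

end

/-! The proof is a good-`λ` argument in which the span `E` plays the role that constants play for
the Fefferman–Stein sharp function. What replaces the triviality "a constant is bounded by its mean"
is a Nikolskii inequality (`exists_enorm_le_ballMean`): on a ball, an element of `E` is bounded by
`κ` times its `L^s` mean over the triple ball, with `κ` of order `N^{max(1/2,1/s)}` whatever the
frequencies. For `s = 2` it comes from the Christoffel function, whose mean over a ball is the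
dimension, combined with the translation invariance of `E`; smaller `s` follows by interpolating
inside a weighted supremum, larger `s` by Jensen.

Fix a big dyadic cube and attach to each cell a comparable ball. On a maximal cell where the mean of
`f` exceeds `a`, the parent keeps the mean below `2^{n/s} a`, so the best approximation `P` on its
ball is at most `b`, where `b` is of order `κ a`. Any smaller ball inside with mean of `f` above
`2b` then has mean of `f - P` above `b`. If the sharp function is at most `τ` somewhere in the cell,
the weak type bound makes the set of such points a fraction at most `5^n (τ/b)^s` of the ball
(`rpow_mul_volume_le`). The reverse Hölder condition turns this into a `ω`-fraction of order
`(τ/b)^{s/t}`, and doubling passes from the ball back to the cell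
(`weightMeasure_superlevel_inter_le`).

Summing over the levels `2^j a`, a jump of `l` levels with `2^l` of order `κ` costs `κ^p`, so
absorption needs `τ/b` of order `κ^{-tp/s}`; this is where the power of `N` comes from. The sum
starts at the mean of `f` over the top ball. Since `f ∈ L^s`, that mean is dominated by the sharp
function once the ball is large (`exists_forall_ballMean_le_sharpMaximal`), so nothing is lost at
the bottom. Lebesgue differentiation recovers `|f|` from the cell means, and the cube is finally
exhausted to all of space. -/

namespace MultiFreq

/-! ### Nikolskii's inequality for sums of plane waves -/

section Nikolskii

variable {n : ℕ} {Θ : Finset (EuclideanSpace ℝ (Fin n))}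

theorem continuous_of_mem_expSpan {φ : EuclideanSpace ℝ (Fin n) → ℂ} (hφ : φ ∈ expSpan Θ) :
    Continuous φ := by
  unfold expSpan at hφ
  induction hφ using Submodule.span_induction with
  | mem x hx =>
    obtain ⟨ξ, -, rfl⟩ := hx
    exact continuous_planeWave ξ
  | zero => exact continuous_const
  | add x y _ _ hx hy => exact hx.add hy
  | smul a x _ hx => exact hx.const_smul a

theorem exists_norm_le_of_mem_expSpan {φ : EuclideanSpace ℝ (Fin n) → ℂ} (hφ : φ ∈ expSpan Θ) :
    ∃ C : ℝ, ∀ x, ‖φ x‖ ≤ C := by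
  unfold expSpan at hφ
  induction hφ using Submodule.span_induction with
  | mem x hx =>
    obtain ⟨ξ, -, rfl⟩ := hx
    exact ⟨1, fun x => (norm_planeWave ξ x).le⟩
  | zero => exact ⟨0, fun x => by simp⟩
  | add x y _ _ hx hy =>
    obtain ⟨C, hC⟩ := hx
    obtain ⟨D, hD⟩ := hy
    exact ⟨C + D, fun z => (norm_add_le _ _).trans (add_le_add (hC z) (hD z))⟩
  | smul a x _ hx =>
    obtain ⟨C, hC⟩ := hx
    exact ⟨‖a‖ * C, fun z => by
      simpa using mul_le_mul_of_nonneg_left (hC z) (norm_nonneg a)⟩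

theorem comp_add_right_mem_expSpan {φ : EuclideanSpace ℝ (Fin n) → ℂ} (hφ : φ ∈ expSpan Θ)
    (a : EuclideanSpace ℝ (Fin n)) : (fun x => φ (x + a)) ∈ expSpan Θ := by
  unfold expSpan at hφ
  induction hφ using Submodule.span_induction with
  | mem x hx =>
    obtain ⟨ξ, hξ, rfl⟩ := hx
    have : (fun x => planeWave ξ (x + a)) = planeWave ξ a • planeWave ξ := by
      ext x
      simp only [planeWave, Pi.smul_apply, smul_eq_mul, ← Complex.exp_add, inner_add_right]
      push_cast
      ring_nf
    rw [this]
    exact Submodule.smul_mem _ _ (Submodule.subset_span ⟨ξ, hξ, rfl⟩)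
  | zero => exact Submodule.zero_mem _
  | add x y _ _ hx hy => exact Submodule.add_mem _ hx hy
  | smul a x _ hx => exact Submodule.smul_mem _ _ hx

/-- An orthonormal basis of the range of `L` is lifted to `V`. Working modulo the kernel avoids
having to show that a nonzero sum of plane waves cannot vanish on a ball. -/
theorem exists_orthonormal_lift {V H : Type*} [AddCommGroup V] [Module ℂ V]
    [FiniteDimensional ℂ V] [NormedAddCommGroup H] [InnerProductSpace ℂ H] (L : V →ₗ[ℂ] H) :
    ∃ d ≤ Module.finrank ℂ V, ∃ e : Fin d → V, (∀ j, ‖L (e j)‖ = 1) ∧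
      ∀ f, ∃ a : Fin d → ℂ, L (f - ∑ j, a j • e j) = 0 ∧ ∑ j, ‖a j‖ ^ 2 = ‖L f‖ ^ 2 := by
  let b := stdOrthonormalBasis ℂ (LinearMap.range L)
  have he : ∀ j, ∃ e : V, L e = b j := fun j => (b j).2
  choose e he using he
  refine ⟨_, LinearMap.finrank_range_le L, e, fun j => ?_, fun f => ?_⟩
  · rw [he]
    exact b.orthonormal.1 j
  · let F : LinearMap.range L := ⟨L f, f, rfl⟩
    refine ⟨fun j => inner ℂ (b j) F, ?_, b.sum_sq_norm_inner_right F⟩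
    rw [map_sub, map_sum, sub_eq_zero]
    have := congrArg Subtype.val (b.sum_repr' F)
    rw [Submodule.coe_sum] at this
    simp only [map_smul, he]
    exact this.symm

/-- Some point of a ball has Christoffel function at most its mean, which is the dimension. -/
theorem exists_sq_enorm_mul_volume_le (Θ : Finset (EuclideanSpace ℝ (Fin n)))
    (c : EuclideanSpace ℝ (Fin n)) {r : ℝ} (hr : 0 < r) :
    ∃ y ∈ ball c r, ∀ f ∈ expSpan Θ,
      ‖f y‖ₑ ^ 2 * volume (ball c r) ≤ Θ.card * ∫⁻ x in ball c r, ‖f x‖ₑ ^ 2 := by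
  have : IsFiniteMeasure (volume.restrict (ball c r)) :=
    isFiniteMeasure_restrict.2 measure_ball_lt_top.ne
  have : FiniteDimensional ℂ (expSpan Θ) :=
    FiniteDimensional.span_of_finite ℂ (Θ.finite_toSet.image _)
  let L : expSpan Θ →ₗ[ℂ] Lp ℂ 2 (volume.restrict (ball c r)) :=
    { toFun := fun φ => (memLp_of_mem_expSpan φ.2 2 _).toLp φ.1
      map_add' := fun φ ψ => MemLp.toLp_add _ _
      map_smul' := fun a φ => MemLp.toLp_const_smul a _ }
  have hL : ∀ f : expSpan Θ, ‖L f‖ₑ ^ 2 = ∫⁻ x in ball c r, ‖f.1 x‖ₑ ^ 2 := by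
    intro f
    have h := eLpNorm_nnreal_pow_eq_lintegral (f := f.1) (μ := volume.restrict (ball c r))
      (p := 2) (by norm_num)
    have h2 : ‖L f‖ₑ = eLpNorm f.1 2 (volume.restrict (ball c r)) :=
      Lp.enorm_toLp (memLp_of_mem_expSpan f.2 2 _)
    rw [h2]
    simpa using h
  have hker : ∀ f : expSpan Θ, L f = 0 → ∀ x ∈ ball c r, f.1 x = 0 := by
    intro f hf
    have h0 : f.1 =ᵐ[volume.restrict (ball c r)] fun _ => (0 : ℂ) := by
      have h1 : L f = MemLp.toLp (0 : EuclideanSpace ℝ (Fin n) → ℂ) MemLp.zero := by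
        rw [hf]; rfl
      exact (MemLp.toLp_eq_toLp_iff (memLp_of_mem_expSpan f.2 2 _) MemLp.zero).1 h1
    exact Measure.eqOn_open_of_ae_eq h0 isOpen_ball (continuous_of_mem_expSpan f.2).continuousOn
      continuousOn_const
  have hd : Module.finrank ℂ (expSpan Θ) ≤ Θ.card := by
    classical
    have h1 : expSpan Θ = Submodule.span ℂ (Θ.image planeWave : Set _) := by simp [expSpan]
    rw [h1]
    exact (finrank_span_finset_le_card _).trans Finset.card_image_le
  obtain ⟨d, hdd, e, he, hbasis⟩ := exists_orthonormal_lift L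
  -- The Christoffel function `∑ |e_j|²` integrates to `d` over the ball, so at some point it is at
  -- most `d / |B|`; Cauchy–Schwarz in the coefficients of `f` does the rest.
  obtain ⟨y, hy, hle⟩ := exists_le_setLAverage (μ := volume) (s := ball c r)
    (f := fun y => ∑ j, ‖(e j).1 y‖ₑ ^ 2) (measure_ball_pos _ _ hr).ne' measure_ball_lt_top.ne
    (Finset.aemeasurable_fun_sum _ fun j _ =>
      ((continuous_of_mem_expSpan (e j).2).enorm.measurable.pow_const 2).aemeasurable)
  refine ⟨y, hy, fun f hf => ?_⟩
  set F : expSpan Θ := ⟨f, hf⟩ with hF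
  obtain ⟨a, hsum, h1⟩ := hbasis F
  have hfy : f y = ∑ j, a j * (e j).1 y := by
    have := hker _ hsum y hy
    simpa [sub_eq_zero, hF, Finset.sum_apply] using this
  have hcs : ‖f y‖ ^ 2 ≤ ‖L F‖ ^ 2 * ∑ j, ‖(e j).1 y‖ ^ 2 := by
    rw [← h1]
    refine le_trans ?_ (Finset.sum_mul_sq_le_sq_mul_sq _ _ _)
    gcongr
    rw [hfy]
    exact (norm_sum_le _ _).trans (by simp)
  have hcs' : ‖f y‖ₑ ^ 2 ≤ ‖L F‖ₑ ^ 2 * ∑ j, ‖(e j).1 y‖ₑ ^ 2 := by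
    have h := ENNReal.ofReal_le_ofReal hcs
    rw [ENNReal.ofReal_mul (by positivity), ENNReal.ofReal_sum_of_nonneg (by intros; positivity)]
      at h
    simpa [ENNReal.ofReal_pow] using h
  have hint : ∫⁻ y in ball c r, ∑ j, ‖(e j).1 y‖ₑ ^ 2 =
      (d : ℝ≥0∞) := by
    rw [lintegral_finsetSum _ fun j _ =>
      (continuous_of_mem_expSpan (e j).2).enorm.measurable.pow_const 2]
    have : ∀ j, ∫⁻ y in ball c r, ‖(e j).1 y‖ₑ ^ 2 = 1 := by
      intro j
      rw [← hL, ← ofReal_norm, he]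
      simp
    simp [this]
  rw [setLAverage_eq, hint] at hle
  have hv0 := (measure_ball_pos volume c hr).ne'
  have hvt : volume (ball c r) ≠ ∞ := measure_ball_lt_top.ne
  calc ‖f y‖ₑ ^ 2 * volume (ball c r)
      ≤ (‖L F‖ₑ ^ 2 * (d / volume (ball c r))) *
        volume (ball c r) := by gcongr; exact hcs'.trans (by gcongr)
    _ = d * ‖L F‖ₑ ^ 2 := by
        rw [mul_assoc, ENNReal.div_mul_cancel hv0 hvt, mul_comm]
    _ ≤ Θ.card * ∫⁻ x in ball c r, ‖f x‖ₑ ^ 2 := by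
        rw [hL]
        gcongr
        exact hdd.trans hd

/-- The good point `y` depends only on the ball and on `Θ`, and the span is translation invariant:
moving `y` to the center `x` makes the bound hold at `x`, and the moved ball stays inside the
doubled one. -/
theorem sq_enorm_mul_volume_le {f : EuclideanSpace ℝ (Fin n) → ℂ} (hf : f ∈ expSpan Θ)
    (x : EuclideanSpace ℝ (Fin n)) {r : ℝ} (hr : 0 < r) :
    ‖f x‖ₑ ^ 2 * volume (ball x r) ≤ Θ.card * ∫⁻ y in ball x (2 * r), ‖f y‖ₑ ^ 2 := by
  obtain ⟨y, hy, h⟩ := exists_sq_enorm_mul_volume_le Θ x hr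
  have h1 := h _ (comp_add_right_mem_expSpan hf (x - y))
  simp only [add_sub_cancel] at h1
  refine h1.trans (mul_le_mul_right ?_ _)
  rw [← lintegral_indicator measurableSet_ball, ← lintegral_indicator measurableSet_ball,
    ← lintegral_add_right_eq_self
       ((ball x (2 * r)).indicator fun y => ‖f y‖ₑ ^ 2) (x - y)]
  refine lintegral_mono fun z => ?_
  by_cases hz : z ∈ ball x r
  · have : z + (x - y) ∈ ball x (2 * r) := by
      rw [mem_ball, dist_eq_norm] at *
      have h3 : z + (x - y) - x = (z - x) - (y - x) := by abel
      rw [h3]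
      linarith [norm_sub_le (z - x) (y - x)]
    simp [hz, this]
  · simp [hz]

theorem volume_ball_eq (x : EuclideanSpace ℝ (Fin n)) {r : ℝ} (hr : 0 < r) :
    volume (ball x r) = ENNReal.ofReal r ^ n * volume (ball (0 : EuclideanSpace ℝ (Fin n)) 1) := by
  rw [Measure.addHaar_ball_of_pos _ _ hr, ENNReal.ofReal_pow hr.le]
  simp

/-- The bound of `sq_enorm_mul_volume_le` with the exponent `2` lowered to `s`. -/
theorem rpow_enorm_mul_volume_le {s : ℝ} (hs : 0 < s) (hs2 : s ≤ 2)
    {f : EuclideanSpace ℝ (Fin n) → ℂ} (hf : f ∈ expSpan Θ)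
    (c : EuclideanSpace ℝ (Fin n)) {r : ℝ} (hr : 0 < r) {x : EuclideanSpace ℝ (Fin n)}
    (hx : x ∈ ball c r) :
    ‖f x‖ₑ ^ s * volume (ball c r) ≤
      4 ^ n * 2 ^ (2 * n / s - n) * (Θ.card * ∫⁻ y in ball c (3 * r), ‖f y‖ₑ ^ s) := by
  set v := volume (ball (0 : EuclideanSpace ℝ (Fin n)) 1) with hv
  have hv0 : v ≠ 0 := (measure_ball_pos _ _ one_pos).ne'
  have hvt : v ≠ ∞ := measure_ball_lt_top.ne
  set I := ∫⁻ y in ball c (3 * r), ‖f y‖ₑ ^ s with hI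
  set D : EuclideanSpace ℝ (Fin n) → ℝ≥0∞ := fun y => ENNReal.ofReal (3 * r - dist y c) with hD
  -- Weighting by a power of the distance `D` to the boundary allows the supremum to reappear on the
  -- right, over smaller balls, with power `2 - s < 2`, and be cancelled. Its finiteness, from the
  -- boundedness of `f`, is what makes the cancellation legitimate.
  set G := ⨆ y ∈ ball c (3 * r), D y ^ (n / s) * ‖f y‖ₑ with hG
  have hGt : G ≠ ∞ := by
    obtain ⟨B, hB⟩ := exists_norm_le_of_mem_expSpan hf
    refine ne_top_of_le_ne_top (b := ENNReal.ofReal (3 * r) ^ (n / s) * ENNReal.ofReal B) ?_ ?_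
    · exact ENNReal.mul_ne_top (ENNReal.rpow_ne_top_of_nonneg (by positivity) ENNReal.ofReal_ne_top)
        ENNReal.ofReal_ne_top
    · refine iSup₂_le fun y hy => ?_
      gcongr
      · simp only [hD]
        gcongr
        linarith [dist_nonneg (x := y) (y := c)]
      · rw [← ofReal_norm]
        exact ENNReal.ofReal_le_ofReal (hB y)
  have hle : ∀ y ∈ ball c (3 * r), D y ^ (n / s) * ‖f y‖ₑ ≤ G := fun y hy =>
    le_iSup₂ (f := fun y (_ : y ∈ ball c (3 * r)) => D y ^ (n / s) * ‖f y‖ₑ) y hy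
  have hstep : ∀ y ∈ ball c (3 * r), (D y ^ (n / s) * ‖f y‖ₑ) ^ 2 * v ≤
      4 ^ n * 2 ^ (2 * n / s - n) * (Θ.card * I) * G ^ (2 - s) := by
    intro y hy
    have hy' : dist y c < 3 * r := hy
    set d := 3 * r - dist y c with hd
    have hd0 : 0 < d := by linarith
    have hDy : D y = ENNReal.ofReal d := rfl
    set δ := ENNReal.ofReal d with hδ
    have hδ0 : δ ≠ 0 := by simpa [hδ] using hd0
    have hδt : δ ≠ ∞ := ENNReal.ofReal_ne_top
    -- Radius `d/4` keeps the doubled ball at distance at least `d/2` from the boundary, so that `D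
    -- ≥ δ/2` there.
    have h1 := sq_enorm_mul_volume_le hf y (r := d / 4) (by positivity)
    rw [volume_ball_eq y (by positivity), ← hv] at h1
    have h2 : ∫⁻ z in ball y (2 * (d / 4)), ‖f z‖ₑ ^ 2 ≤
        (G * (δ / 2) ^ (-(n / s) : ℝ)) ^ (2 - s) * I := by
      rw [hI, ← lintegral_const_mul' _ _ (ENNReal.rpow_ne_top_of_nonneg (by linarith)
        (ENNReal.mul_ne_top hGt (ENNReal.rpow_ne_top_of_ne_zero
          (by simpa using hδ0) (by simpa [ENNReal.div_eq_top] using hδt))))]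
      have hsub : ball y (2 * (d / 4)) ⊆ ball c (3 * r) :=
        ball_subset_ball' (by linarith)
      refine le_trans ?_ (lintegral_mono_set hsub)
      refine setLIntegral_mono' measurableSet_ball fun z hz => ?_
      have hz' : dist z y < 2 * (d / 4) := hz
      have hpow : ‖f z‖ₑ ^ 2 = ‖f z‖ₑ ^ (2 - s) * ‖f z‖ₑ ^ s := by
        rw [← ENNReal.rpow_add_of_nonneg _ _ (by linarith) hs.le, sub_add_cancel,
          ← ENNReal.rpow_ofNat]
      rw [hpow]
      gcongr
      have h3 := hle z (hsub hz)
      have h4 : δ / 2 ≤ D z := by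
        have h5 : δ / 2 = ENNReal.ofReal (d / 2) := by
          rw [ENNReal.ofReal_div_of_pos two_pos, ENNReal.ofReal_ofNat]
        rw [h5]
        refine ENNReal.ofReal_le_ofReal ?_
        linarith [dist_triangle z y c]
      have h5 : (δ / 2) ^ (n / s : ℝ) * ‖f z‖ₑ ≤ G := le_trans (by gcongr) h3
      rw [ENNReal.rpow_neg, ← div_eq_mul_inv,
        ENNReal.le_div_iff_mul_le
        (Or.inl (ENNReal.rpow_pos (by simpa [pos_iff_ne_zero] using hδ0) (by simpa [ENNReal.div_eq_top])).ne')
        (Or.inl (ENNReal.rpow_ne_top_of_nonneg (by positivity) (by simpa [ENNReal.div_eq_top])))]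
      rwa [mul_comm]
    have he : (n / s : ℝ) * (2 - s) = 2 * n / s - n := by field_simp
    have he0 : 0 ≤ 2 * n / s - n := by
      rw [← he]
      exact mul_nonneg (by positivity) (by linarith)
    set e : ℝ := 2 * n / s - n with hedef
    have hδ4 : δ = 4 * ENNReal.ofReal (d / 4) := by
      rw [show (4 : ℝ≥0∞) = ENNReal.ofReal 4 by simp, ← ENNReal.ofReal_mul (by norm_num),
        mul_div_cancel₀ _ (by norm_num)]
    have hδ2 : δ ^ e = 2 ^ e * (δ / 2) ^ e := by
      rw [← ENNReal.mul_rpow_of_nonneg _ _ he0, ENNReal.mul_div_cancel (by norm_num) (by norm_num)]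
    have hδ2' : (δ / 2) ^ e * (δ / 2) ^ (-e) = 1 := by
      rw [ENNReal.rpow_neg]
      exact ENNReal.mul_inv_cancel
        (ENNReal.rpow_pos (by simpa [pos_iff_ne_zero] using hδ0)
          (by simpa [ENNReal.div_eq_top])).ne'
        (ENNReal.rpow_ne_top_of_nonneg he0 (by simpa [ENNReal.div_eq_top]))
    have hpow : (δ ^ (n / s : ℝ)) ^ 2 = δ ^ e * (4 ^ n * ENNReal.ofReal (d / 4) ^ n) := by
      rw [← mul_pow, ← hδ4, ← ENNReal.rpow_natCast δ n, ← ENNReal.rpow_add _ _ hδ0 hδt,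
        ← ENNReal.rpow_natCast, ← ENNReal.rpow_mul]
      congr 1
      rw [hedef]
      push_cast
      ring
    calc (D y ^ (n / s : ℝ) * ‖f y‖ₑ) ^ 2 * v
        = δ ^ e * 4 ^ n * (‖f y‖ₑ ^ 2 * (ENNReal.ofReal (d / 4) ^ n * v)) := by
          rw [mul_pow, hDy, hpow]
          ring
      _ ≤ δ ^ e * 4 ^ n * (Θ.card * ((G * (δ / 2) ^ (-(n / s) : ℝ)) ^ (2 - s) * I)) := by
          refine mul_le_mul_right (h1.trans ?_) _
          gcongr
      _ = 4 ^ n * 2 ^ e * (Θ.card * I) * G ^ (2 - s) * ((δ / 2) ^ e * (δ / 2) ^ (-e)) := by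
          rw [ENNReal.mul_rpow_of_nonneg _ _ (by linarith), ← ENNReal.rpow_mul, neg_mul, he, hδ2]
          ring
      _ = _ := by rw [hδ2', mul_one]
  have hGs : G ^ s * v ≤ 4 ^ n * 2 ^ (2 * n / s - n) * (Θ.card * I) := by
    by_cases hG0 : G = 0
    · rw [hG0, ENNReal.zero_rpow_of_pos hs, zero_mul]
      exact zero_le
    · have h1 : G ^ 2 * v ≤ 4 ^ n * 2 ^ (2 * n / s - n) * (Θ.card * I) * G ^ (2 - s) := by
        rw [← ENNReal.le_div_iff_mul_le (Or.inl hv0) (Or.inl hvt), ← ENNReal.rpow_ofNat,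
          ← ENNReal.le_rpow_inv_iff (by norm_num)]
        refine iSup₂_le fun y hy => ?_
        rw [ENNReal.le_rpow_inv_iff (by norm_num), ENNReal.rpow_ofNat,
          ENNReal.le_div_iff_mul_le (Or.inl hv0) (Or.inl hvt)]
        exact hstep y hy
      have h2 : G ^ 2 = G ^ s * G ^ (2 - s) := by
        rw [← ENNReal.rpow_add_of_nonneg _ _ hs.le (by linarith), add_sub_cancel,
          ← ENNReal.rpow_ofNat]
      rw [h2, mul_right_comm] at h1
      exact (ENNReal.mul_le_mul_iff_left (ENNReal.rpow_pos (pos_iff_ne_zero.2 hG0) hGt).ne'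
        (ENNReal.rpow_ne_top_of_nonneg (by linarith) hGt)).1 h1
  refine le_trans ?_ hGs
  have hx' : dist x c < r := hx
  have h1 := hle x (ball_subset_ball (by linarith) hx)
  rw [volume_ball_eq c hr, ← hv, ← mul_assoc]
  -- At `x ∈ B(c, r)` the distance to the boundary of `B(c, 3r)` is at least `2r`, so the weight is
  -- at least `r^{n/s}`.
  gcongr
  calc ‖f x‖ₑ ^ s * ENNReal.ofReal r ^ n = (ENNReal.ofReal r ^ (n / s) * ‖f x‖ₑ) ^ s := by
        rw [ENNReal.mul_rpow_of_nonneg _ _ hs.le, ← ENNReal.rpow_mul, div_mul_cancel₀ _ hs.ne',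
          ENNReal.rpow_natCast, mul_comm]
    _ ≤ G ^ s := by
        gcongr
        refine le_trans ?_ h1
        gcongr
        exact ENNReal.ofReal_le_ofReal (by linarith)

theorem ballMean_rpow {s : ℝ} (hs : 0 < s) {F : Type*} [NormedAddCommGroup F]
    (c : EuclideanSpace ℝ (Fin n)) (r : ℝ) (h : EuclideanSpace ℝ (Fin n) → F) :
    ballMean (ENNReal.ofReal s) c r h ^ s =
      (volume (ball c r))⁻¹ * ∫⁻ x in ball c r, ‖h x‖ₑ ^ s := by
  rw [ballMean, eLpNorm_eq_lintegral_rpow_enorm_toReal (by simpa) ENNReal.ofReal_ne_top,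
    ENNReal.toReal_ofReal hs.le, ← ENNReal.rpow_mul, one_div_mul_cancel hs.ne', ENNReal.rpow_one,
    lintegral_smul_measure, smul_eq_mul]

theorem isProbabilityMeasure_ball (c : EuclideanSpace ℝ (Fin n)) {r : ℝ} (hr : 0 < r) :
    IsProbabilityMeasure ((volume (ball c r))⁻¹ • volume.restrict (ball c r)) := by
  constructor
  rw [Measure.smul_apply, Measure.restrict_apply_univ, smul_eq_mul]
  exact ENNReal.inv_mul_cancel (measure_ball_pos _ _ hr).ne' measure_ball_lt_top.ne

/-- Nikolskii's inequality for sums of plane waves. -/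
theorem exists_enorm_le_ballMean (n : ℕ) {s : ℝ} (hs : 1 ≤ s) :
    ∃ C : ℝ≥0, ∀ (Θ : Finset (EuclideanSpace ℝ (Fin n))), ∀ f ∈ expSpan Θ,
      ∀ (c : EuclideanSpace ℝ (Fin n)) (r : ℝ), 0 < r → ∀ x ∈ ball c r,
      ‖f x‖ₑ ≤ C * (Θ.card : ℝ≥0∞) ^ max (1 / 2) (1 / s) *
        ballMean (ENNReal.ofReal s) c (3 * r) f := by
  have key : ∀ s : ℝ, 0 < s → s ≤ 2 → ∃ C : ℝ≥0, ∀ (Θ : Finset (EuclideanSpace ℝ (Fin n))),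
      ∀ f ∈ expSpan Θ, ∀ (c : EuclideanSpace ℝ (Fin n)) (r : ℝ), 0 < r → ∀ x ∈ ball c r,
      ‖f x‖ₑ ≤ C * (Θ.card : ℝ≥0∞) ^ (1 / s) * ballMean (ENNReal.ofReal s) c (3 * r) f := by
    intro s hs hs2
    have hC : (4 ^ n * 2 ^ (2 * n / s - n) * 3 ^ n : ℝ≥0∞) ^ (1 / s) ≠ ∞ := by
      refine ENNReal.rpow_ne_top_of_nonneg (by positivity) ?_
      refine ENNReal.mul_ne_top (ENNReal.mul_ne_top (by simp) ?_) (by simp)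
      exact ENNReal.rpow_ne_top_of_ne_zero (by simp) (by simp)
    refine ⟨((4 ^ n * 2 ^ (2 * n / s - n) * 3 ^ n : ℝ≥0∞) ^ (1 / s)).toNNReal,
      fun Θ f hf c r hr x hx => ?_⟩
    rw [ENNReal.coe_toNNReal hC, ← ENNReal.rpow_le_rpow_iff hs, ENNReal.mul_rpow_of_nonneg _ _ hs.le,
      ENNReal.mul_rpow_of_nonneg _ _ hs.le, ballMean_rpow hs, ← ENNReal.rpow_mul,
      ← ENNReal.rpow_mul, one_div_mul_cancel hs.ne', ENNReal.rpow_one, ENNReal.rpow_one]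
    have h := rpow_enorm_mul_volume_le hs hs2 hf c hr hx
    have hv0 := (measure_ball_pos volume c hr).ne'
    have hvt : volume (ball c r) ≠ ∞ := measure_ball_lt_top.ne
    have hv3 : volume (ball c (3 * r)) = 3 ^ n * volume (ball c r) := by
      rw [volume_ball_eq c hr, volume_ball_eq c (by positivity),
        ENNReal.ofReal_mul (by norm_num), mul_pow, ENNReal.ofReal_ofNat, mul_assoc]
    rw [hv3, ENNReal.mul_inv (by simp) (by simp)]
    rw [← ENNReal.le_div_iff_mul_le (Or.inl hv0) (Or.inl hvt)] at h
    refine h.trans_eq ?_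
    have h3 : (3 ^ n : ℝ≥0∞) * (3 ^ n)⁻¹ = 1 := ENNReal.mul_inv_cancel (by simp) (by simp)
    rw [div_eq_mul_inv]
    calc _ = 4 ^ n * 2 ^ (2 * n / s - n) * (Θ.card * ∫⁻ y in ball c (3 * r), ‖f y‖ₑ ^ s) *
          (volume (ball c r))⁻¹ * ((3 ^ n : ℝ≥0∞) * (3 ^ n)⁻¹) := by rw [h3, mul_one]
      _ = _ := by ring
  -- For `s ≥ 2` the case of exponent `2` is used, since `L²` means are at most `L^s` means.
  rcases le_total s 2 with h2 | h2
  · obtain ⟨C, hC⟩ := key s (by linarith) h2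
    refine ⟨C, ?_⟩
    rwa [max_eq_right (one_div_le_one_div_of_le (by linarith) h2)]
  · obtain ⟨C, hC⟩ := key 2 two_pos le_rfl
    refine ⟨C, fun Θ f hf c r hr x hx => (hC Θ f hf c r hr x hx).trans ?_⟩
    rw [max_eq_left (one_div_le_one_div_of_le two_pos h2)]
    gcongr
    have := isProbabilityMeasure_ball c (r := 3 * r) (by positivity)
    exact eLpNorm_le_eLpNorm_of_exponent_le (ENNReal.ofReal_le_ofReal h2)
      (continuous_of_mem_expSpan hf).aestronglyMeasurable

end Nikolskii

/-! ### The weak type bound, and reverse Hölder weights -/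

section Weights

variable {n : ℕ}

/-- The weak type `(1, 1)` bound for the Hardy-Littlewood maximal operator. -/
theorem mul_volume_le_of_forall_exists_ball {g : EuclideanSpace ℝ (Fin n) → ℝ≥0∞} {a : ℝ≥0∞}
    {S : Set (EuclideanSpace ℝ (Fin n))} {R : ℝ}
    (hS : ∀ x ∈ S, ∃ c r, 0 < r ∧ r ≤ R ∧ x ∈ ball c r ∧
      a * volume (ball c r) ≤ ∫⁻ y in ball c r, g y) :
    a * volume S ≤ 5 ^ n * ∫⁻ y, g y := by
  choose! c r hr hrR hx hle using hS
  obtain ⟨u, hu, hdisj, hcov⟩ := Vitali.exists_disjoint_subfamily_covering_enlargement_ball S c r R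
    hrR 5 (by norm_num)
  have hcount : u.Countable := hdisj.countable_of_isOpen (fun x _ => isOpen_ball)
    (fun x hxu => ⟨x, hx x (hu hxu)⟩)
  have hsub : S ⊆ ⋃ b ∈ u, ball (c b) (5 * r b) := by
    intro x hxS
    obtain ⟨b, hb, hsub⟩ := hcov x hxS
    exact Set.mem_biUnion hb (hsub (hx x hxS))
  calc a * volume S ≤ a * ∑' b : u, volume (ball (c b) (5 * r b)) := by
        gcongr
        exact (measure_mono hsub).trans (measure_biUnion_le _ hcount _)
    _ = 5 ^ n * ∑' b : u, a * volume (ball (c b) (r b)) := by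
        rw [← ENNReal.tsum_mul_left, ← ENNReal.tsum_mul_left]
        congr 1 with b
        have hb := hr b (hu b.2)
        rw [volume_ball_eq (c b) hb, volume_ball_eq (c b) (by positivity),
          ENNReal.ofReal_mul (by norm_num), mul_pow, ENNReal.ofReal_ofNat]
        ring
    _ ≤ 5 ^ n * ∑' b : u, ∫⁻ y in ball (c b) (r b), g y := by
        gcongr with b
        exact hle b (hu b.2)
    _ = 5 ^ n * ∫⁻ y in ⋃ b ∈ u, ball (c b) (r b), g y := by
        rw [lintegral_biUnion hcount (fun _ _ => measurableSet_ball) hdisj]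
    _ ≤ 5 ^ n * ∫⁻ y, g y := by
        gcongr
        exact Measure.restrict_le_self

theorem weightMeasure_apply (ω : EuclideanSpace ℝ (Fin n) → ℝ)
    (S : Set (EuclideanSpace ℝ (Fin n))) :
    weightMeasure ω S = ∫⁻ x in S, ENNReal.ofReal (ω x) :=
  withDensity_apply' _ _

theorem IsWeight.integrableOn_ball {ω : EuclideanSpace ℝ (Fin n) → ℝ} (hω : IsWeight ω)
    (c : EuclideanSpace ℝ (Fin n)) (r : ℝ) : IntegrableOn ω (ball c r) :=
  (hω.locallyIntegrable.integrableOn_isCompact (isCompact_closedBall c r)).mono_set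
    ball_subset_closedBall

theorem IsWeight.weightMeasure_ball {ω : EuclideanSpace ℝ (Fin n) → ℝ} (hω : IsWeight ω)
    (c : EuclideanSpace ℝ (Fin n)) (r : ℝ) :
    weightMeasure ω (ball c r) = ENNReal.ofReal (∫ x in ball c r, ω x) := by
  rw [weightMeasure_apply, ofReal_integral_eq_lintegral_ofReal (hω.integrableOn_ball c r)
    (Filter.Eventually.of_forall hω.nonneg)]

theorem IsWeight.weightMeasure_ball_ne_top {ω : EuclideanSpace ℝ (Fin n) → ℝ} (hω : IsWeight ω)
    (c : EuclideanSpace ℝ (Fin n)) (r : ℝ) : weightMeasure ω (ball c r) ≠ ∞ := by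
  rw [hω.weightMeasure_ball]
  exact ENNReal.ofReal_ne_top

theorem weightMeasure_absolutelyContinuous (ω : EuclideanSpace ℝ (Fin n) → ℝ) :
    weightMeasure ω ≪ volume :=
  withDensity_absolutelyContinuous _ _

/-- A reverse Hölder weight is absolutely continuous on balls, quantitatively. -/
theorem ReverseHolder.weightMeasure_le {t : ℝ} (ht : 1 ≤ t) {A : ℝ≥0}
    {ω : EuclideanSpace ℝ (Fin n) → ℝ}
    (hω : ReverseHolder (ENNReal.conjExponent (ENNReal.ofReal t)) A ω)
    {c : EuclideanSpace ℝ (Fin n)} {r : ℝ} (hr : 0 < r) {S : Set (EuclideanSpace ℝ (Fin n))}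
    (hS : S ⊆ ball c r) :
    weightMeasure ω S ≤
      A * (volume S / volume (ball c r)) ^ (1 / t) * weightMeasure ω (ball c r) := by
  have ht0 : 0 < t := by linarith
  have hv0 := (measure_ball_pos volume c hr).ne'
  have hvt : volume (ball c r) ≠ ∞ := measure_ball_lt_top.ne
  -- A measurable hull, cut down to the ball, has the same volume bound and only increases the
  -- weight.
  wlog hm : MeasurableSet S generalizing S
  · have h := this (S := toMeasurable volume S ∩ ball c r) Set.inter_subset_right
      ((measurableSet_toMeasurable _ _).inter measurableSet_ball)
    refine (measure_mono (Set.subset_inter (subset_toMeasurable volume S) hS)).trans (h.trans ?_)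
    have hle : volume (toMeasurable volume S ∩ ball c r) ≤ volume S :=
      (measure_mono Set.inter_subset_left).trans (measure_toMeasurable S).le
    exact mul_le_mul_left (mul_le_mul_right (by gcongr) _) _
  have : Fact (1 ≤ ENNReal.ofReal t) := ⟨by simpa using ht⟩
  have := isProbabilityMeasure_ball c hr
  set μ := (volume (ball c r))⁻¹ • volume.restrict (ball c r) with hμ
  have hωm : AEStronglyMeasurable ω μ :=
    (hω.isWeight.integrableOn_ball c r).aestronglyMeasurable.smul_measure _
  -- Hölder for `1_S · ω` with exponents `t` and `t'`, in the normalized measure on the ball.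
  have hH := eLpNorm_smul_le_mul_eLpNorm (p := ENNReal.ofReal t)
    (q := ENNReal.conjExponent (ENNReal.ofReal t)) (r := 1) hωm
    (φ := S.indicator fun _ => (1 : ℝ)) (aestronglyMeasurable_const.indicator hm)
  have h1 : eLpNorm ((S.indicator fun _ => (1 : ℝ)) • ω) 1 μ =
      (volume (ball c r))⁻¹ * weightMeasure ω S := by
    rw [eLpNorm_one_eq_lintegral_enorm, hμ, lintegral_smul_measure, smul_eq_mul,
      weightMeasure_apply]
    congr 1
    rw [← Set.inter_eq_self_of_subset_left hS, ← Measure.restrict_restrict hm,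
      ← lintegral_indicator hm, Set.inter_eq_self_of_subset_left hS]
    congr 1 with x
    by_cases hx : x ∈ S
    · simp [hx, Real.enorm_eq_ofReal (hω.isWeight.nonneg x)]
    · simp [hx]
  have h2 : eLpNorm (S.indicator fun _ => (1 : ℝ)) (ENNReal.ofReal t) μ =
      (volume S / volume (ball c r)) ^ (1 / t) := by
    rw [eLpNorm_indicator_const hm (by simpa using ht0) ENNReal.ofReal_ne_top,
      ENNReal.toReal_ofReal ht0.le, hμ, Measure.smul_apply, Measure.restrict_apply hm,
      Set.inter_eq_self_of_subset_left hS, smul_eq_mul, ENNReal.div_eq_inv_mul]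
    simp
  have h3 : ENNReal.ofReal (⨍ x in ball c r, ω x) =
      (volume (ball c r))⁻¹ * weightMeasure ω (ball c r) := by
    rw [setAverage_eq, hω.isWeight.weightMeasure_ball, smul_eq_mul,
      ENNReal.ofReal_mul (by positivity), ENNReal.ofReal_inv_of_pos, Measure.real,
      ENNReal.ofReal_toReal hvt]
    exact ENNReal.toReal_pos hv0 hvt
  have h4 := hω.le_mean c r hr
  rw [h3] at h4
  rw [h1, h2] at hH
  rw [← ENNReal.mul_le_mul_iff_right (ENNReal.inv_ne_zero.2 hvt) (ENNReal.inv_ne_top.2 hv0)]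
  refine hH.trans ((mul_le_mul_right h4 _).trans_eq ?_)
  ring

/-- `1 - (1 + δ)^{-n}` is the volume fraction of the annulus between a ball and its `(1 +
δ)`-dilate. It tends to `0` with `δ`, so a thin annulus carries at most half of the weight. -/
theorem exists_dilation_const (n : ℕ) {t : ℝ} (ht : 1 ≤ t) (A : ℝ≥0) :
    ∃ δ : ℝ, 0 < δ ∧ (A : ℝ) * (1 - ((1 + δ) ^ n)⁻¹) ^ (1 / t) ≤ 1 / 2 := by
  have hc : ContinuousAt (fun δ : ℝ => (A : ℝ) * (1 - ((1 + δ) ^ n)⁻¹) ^ (1 / t)) 0 := by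
    refine continuousAt_const.mul (ContinuousAt.rpow_const ?_ (Or.inr (by positivity)))
    refine continuousAt_const.sub (ContinuousAt.inv₀ (by fun_prop) (by simp))
  have h0 : (A : ℝ) * (1 - ((1 + (0 : ℝ)) ^ n)⁻¹) ^ (1 / t) < 1 / 2 := by
    have : (1 / t : ℝ) ≠ 0 := by positivity
    simp [Real.zero_rpow (by simpa using this : t⁻¹ ≠ 0)]
  have hev := hc.eventually_lt continuousAt_const h0
  obtain ⟨δ, hδ, hpos⟩ := ((hev.filter_mono nhdsWithin_le_nhds).and
    (self_mem_nhdsWithin (s := Set.Ioi (0 : ℝ)))).exists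
  exact ⟨δ, hpos, hδ.le⟩

/-- Reverse Hölder weights are doubling. -/
theorem exists_doubling_const (n : ℕ) {t : ℝ} (ht : 1 ≤ t) (A : ℝ≥0) (κ : ℝ) :
    ∃ D : ℝ≥0, ∀ (ω : EuclideanSpace ℝ (Fin n) → ℝ),
      ReverseHolder (ENNReal.conjExponent (ENNReal.ofReal t)) A ω →
      ∀ (c : EuclideanSpace ℝ (Fin n)) (r : ℝ), 0 < r →
        weightMeasure ω (ball c (κ * r)) ≤ D * weightMeasure ω (ball c r) := by
  obtain ⟨δ, hδ, hA⟩ := exists_dilation_const n ht A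
  obtain ⟨j, hj⟩ := pow_unbounded_of_one_lt κ (by linarith : 1 < 1 + δ)
  refine ⟨2 ^ j, fun ω hω c r hr => ?_⟩
  have step : ∀ ρ, 0 < ρ →
      weightMeasure ω (ball c ((1 + δ) * ρ)) ≤ 2 * weightMeasure ω (ball c ρ) := by
    intro ρ hρ
    have hρ' : 0 < (1 + δ) * ρ := by positivity
    have hsub : ball c ρ ⊆ ball c ((1 + δ) * ρ) := ball_subset_ball (by nlinarith)
    have h1 := hω.weightMeasure_le ht hρ'
      (Set.sdiff_subset : ball c ((1 + δ) * ρ) \ ball c ρ ⊆ _)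
    have hq : volume (ball c ((1 + δ) * ρ) \ ball c ρ) / volume (ball c ((1 + δ) * ρ)) =
        ENNReal.ofReal (1 - ((1 + δ) ^ n)⁻¹) := by
      have hv0 := (measure_ball_pos volume c hρ').ne'
      have hvt : volume (ball c ((1 + δ) * ρ)) ≠ ∞ := measure_ball_lt_top.ne
      rw [measure_sdiff hsub measurableSet_ball.nullMeasurableSet measure_ball_lt_top.ne,
        ENNReal.ofReal_sub _ (by positivity), ENNReal.sub_div (fun _ _ => hv0),
        ENNReal.div_self hv0 hvt, ENNReal.ofReal_one]
      congr 1
      have hv1 := (measure_ball_pos volume c hρ).ne'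
      have hv1t : volume (ball c ρ) ≠ ∞ := measure_ball_lt_top.ne
      have : volume (ball c ((1 + δ) * ρ)) = ENNReal.ofReal ((1 + δ) ^ n) * volume (ball c ρ) := by
        rw [volume_ball_eq c hρ', volume_ball_eq c hρ, ENNReal.ofReal_mul (by positivity),
          mul_pow, ENNReal.ofReal_pow (by positivity), mul_assoc]
      rw [this, ENNReal.ofReal_inv_of_pos (by positivity), ENNReal.div_eq_inv_mul,
        ENNReal.mul_inv (Or.inr hv1t) (by simp), mul_assoc, ENNReal.inv_mul_cancel hv1 hv1t, mul_one]
    have hA' : (A : ℝ≥0∞) * ENNReal.ofReal (1 - ((1 + δ) ^ n)⁻¹) ^ (1 / t) ≤ 2⁻¹ := by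
      have hb : (0 : ℝ) ≤ 1 - ((1 + δ) ^ n)⁻¹ := by
        have : ((1 + δ) ^ n)⁻¹ ≤ 1 := inv_le_one_of_one_le₀ (one_le_pow₀ (by linarith))
        linarith
      rw [ENNReal.ofReal_rpow_of_nonneg hb (by positivity), ← ENNReal.ofReal_coe_nnreal,
        ← ENNReal.ofReal_mul (by positivity)]
      refine (ENNReal.ofReal_le_ofReal hA).trans_eq ?_
      rw [one_div, ENNReal.ofReal_inv_of_pos two_pos, ENNReal.ofReal_ofNat]
    rw [hq] at h1
    set W := weightMeasure ω (ball c ((1 + δ) * ρ)) with hW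
    have hWt : W ≠ ∞ := hω.isWeight.weightMeasure_ball_ne_top _ _
    -- The annulus carries at most `W / 2`, which is absorbed because `W` is finite; iterating the
    -- slight dilation reaches any factor `κ`.
    have h2 : W ≤ weightMeasure ω (ball c ρ) + W / 2 := by
      calc W ≤ weightMeasure ω (ball c ρ) +
            weightMeasure ω (ball c ((1 + δ) * ρ) \ ball c ρ) := by
            refine le_trans (measure_mono ?_) (measure_union_le _ _)
            exact (Set.union_sdiff_cancel hsub).ge
        _ ≤ weightMeasure ω (ball c ρ) + W / 2 := by
            gcongr
            rw [ENNReal.div_eq_inv_mul]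
            exact h1.trans (by gcongr)
    have h3 : W / 2 ≤ weightMeasure ω (ball c ρ) := by
      have hne : W / 2 ≠ ∞ := (ENNReal.div_lt_top hWt (by norm_num)).ne
      refine (ENNReal.add_le_add_iff_right hne).1 ?_
      rwa [ENNReal.add_halves]
    rwa [ENNReal.div_le_iff_le_mul (by simp) (by simp), mul_comm] at h3
  have iter : ∀ i : ℕ, weightMeasure ω (ball c ((1 + δ) ^ i * r)) ≤
      2 ^ i * weightMeasure ω (ball c r) := by
    intro i
    induction i with
    | zero => simp
    | succ i ih =>
      rw [pow_succ', mul_assoc, pow_succ', mul_assoc]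
      exact (step _ (by positivity)).trans (by gcongr)
  refine (measure_mono (ball_subset_ball ?_)).trans ((iter j).trans (by simp))
  gcongr

end Weights

/-! ### Dyadic cells and the balls around them -/

section Grid

variable {n : ℕ}

/-- The index of the dyadic cell of generation `k` of the cube `[-L, L)ⁿ` containing `x`. -/
noncomputable def cellIndex (L : ℝ) (k : ℕ) (x : EuclideanSpace ℝ (Fin n)) : Fin n → ℤ :=
  fun i => ⌊2 ^ k * (x i + L) / (2 * L)⌋

/-- The center of a dyadic cell of generation `k`. -/
noncomputable def cellCenter (L : ℝ) (k : ℕ) (m : Fin n → ℤ) : EuclideanSpace ℝ (Fin n) :=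
  WithLp.toLp 2 fun i => 2 * L * (m i + 1 / 2) / 2 ^ k - L

/-- A radius such that the balls around nested dyadic cells are nested. -/
noncomputable def cellRadius (n : ℕ) (L : ℝ) (k : ℕ) : ℝ := 4 * √n * L / 2 ^ k

variable {L : ℝ}

theorem measurable_cellIndex (L : ℝ) (k : ℕ) :
    Measurable (cellIndex L k : EuclideanSpace ℝ (Fin n) → _) := by
  refine measurable_pi_lambda _ fun i => Int.measurable_floor.comp ?_
  fun_prop

theorem cellIndex_congr_of_succ {k : ℕ} {x y : EuclideanSpace ℝ (Fin n)}
    (h : cellIndex L (k + 1) x = cellIndex L (k + 1) y) : cellIndex L k x = cellIndex L k y := by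
  have key : ∀ z : EuclideanSpace ℝ (Fin n), ∀ i,
      cellIndex L k z i = cellIndex L (k + 1) z i / (2 : ℕ) := by
    intro z i
    rw [cellIndex, cellIndex, ← Int.floor_div_natCast]
    congr 1
    push_cast
    ring
  ext i
  rw [key, key, h]

theorem cellIndex_congr_of_le {j k : ℕ} (hjk : j ≤ k) {x y : EuclideanSpace ℝ (Fin n)}
    (h : cellIndex L k x = cellIndex L k y) : cellIndex L j x = cellIndex L j y := by
  induction k, hjk using Nat.le_induction with
  | base => exact h
  | succ k _ ih => exact ih (cellIndex_congr_of_succ h)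

theorem abs_sub_cellCenter_le (hL : 0 < L) (k : ℕ) (x : EuclideanSpace ℝ (Fin n)) (i : Fin n) :
    |x i - cellCenter L k (cellIndex L k x) i| ≤ L / 2 ^ k := by
  have h1 := Int.floor_le (2 ^ k * (x i + L) / (2 * L))
  have h2 := (Int.lt_floor_add_one (2 ^ k * (x i + L) / (2 * L))).le
  have hx : x i = 2 * L * (2 ^ k * (x i + L) / (2 * L)) / 2 ^ k - L := by field_simp; ring
  simp only [cellCenter, cellIndex]
  set u := 2 ^ k * (x i + L) / (2 * L)
  rw [hx]
  have : 2 * L * u / 2 ^ k - L - (2 * L * ((⌊u⌋ : ℝ) + 1 / 2) / 2 ^ k - L) =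
      L / 2 ^ k * (2 * (u - ⌊u⌋) - 1) := by ring
  rw [this, abs_mul, abs_of_pos (by positivity : 0 < L / 2 ^ k)]
  refine mul_le_of_le_one_right (by positivity) ?_
  rw [abs_le]
  constructor <;> linarith

theorem dist_cellCenter_le (hL : 0 < L) (k : ℕ) (x : EuclideanSpace ℝ (Fin n)) :
    dist x (cellCenter L k (cellIndex L k x)) ≤ √n * (L / 2 ^ k) := by
  rw [EuclideanSpace.dist_eq, ← Real.sqrt_sq (by positivity : 0 ≤ L / 2 ^ k),
    ← Real.sqrt_mul (by positivity)]
  refine Real.sqrt_le_sqrt ?_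
  refine (Finset.sum_le_card_nsmul _ _ ((L / 2 ^ k) ^ 2) fun i _ => ?_).trans (by simp)
  rw [Real.dist_eq]
  have := abs_sub_cellCenter_le hL k x i
  gcongr

theorem cellRadius_pos (hn : 1 ≤ n) (hL : 0 < L) (k : ℕ) : 0 < cellRadius n L k := by
  unfold cellRadius
  have : (0 : ℝ) < n := by exact_mod_cast hn
  positivity

theorem cellRadius_succ (n : ℕ) (L : ℝ) (k : ℕ) :
    cellRadius n L k = 2 * cellRadius n L (k + 1) := by
  unfold cellRadius
  rw [pow_succ]
  field_simp

theorem cellRadius_le_of_le (hn : 1 ≤ n) (hL : 0 < L) {j k : ℕ} (hjk : j ≤ k) :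
    cellRadius n L k ≤ cellRadius n L j := by
  induction k, hjk using Nat.le_induction with
  | base => exact le_rfl
  | succ k _ ih =>
    have := cellRadius_succ n L k
    have := cellRadius_pos hn hL (k + 1)
    linarith

theorem mem_ball_cellCenter (hn : 1 ≤ n) (hL : 0 < L) (k : ℕ) (x : EuclideanSpace ℝ (Fin n)) :
    x ∈ ball (cellCenter L k (cellIndex L k x)) (cellRadius n L k) := by
  refine (dist_cellCenter_le hL k x).trans_lt ?_
  unfold cellRadius
  have : (0 : ℝ) < n := by exact_mod_cast hn
  have h : 0 < √(n : ℝ) * (L / 2 ^ k) := by positivity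
  have : 4 * √(n : ℝ) * L / 2 ^ k = 4 * (√(n : ℝ) * (L / 2 ^ k)) := by ring
  linarith

/-- With `u = √n L / 2^k`, the two centers are at most `u + u/2` apart, while the radii `4u` and
`2u` differ by `2u`. -/
theorem ball_cellCenter_succ_subset (hL : 0 < L) (k : ℕ)
    (x : EuclideanSpace ℝ (Fin n)) :
    ball (cellCenter L (k + 1) (cellIndex L (k + 1) x)) (cellRadius n L (k + 1)) ⊆
      ball (cellCenter L k (cellIndex L k x)) (cellRadius n L k) := by
  refine ball_subset_ball' ?_
  have h1 := dist_cellCenter_le hL k x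
  have h2 := dist_cellCenter_le hL (k + 1) x
  have h3 := dist_triangle_left (cellCenter L (k + 1) (cellIndex L (k + 1) x))
    (cellCenter L k (cellIndex L k x)) x
  have h4 : √(n : ℝ) * (L / 2 ^ (k + 1)) = √(n : ℝ) * (L / 2 ^ k) / 2 := by
    rw [pow_succ]; field_simp
  have h5 : cellRadius n L (k + 1) = 2 * (√(n : ℝ) * (L / 2 ^ k)) := by
    unfold cellRadius
    rw [pow_succ]; field_simp; ring
  have h6 := cellRadius_succ n L k
  have : 0 ≤ √(n : ℝ) * (L / 2 ^ k) := by positivity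
  linarith

theorem ball_cellCenter_subset_of_le (hL : 0 < L) {j k : ℕ} (hjk : j ≤ k)
    (x : EuclideanSpace ℝ (Fin n)) :
    ball (cellCenter L k (cellIndex L k x)) (cellRadius n L k) ⊆
      ball (cellCenter L j (cellIndex L j x)) (cellRadius n L j) := by
  induction k, hjk using Nat.le_induction with
  | base => exact subset_rfl
  | succ k _ ih => exact (ball_cellCenter_succ_subset hL k x).trans ih

/-- The inscribed ball of a cell; comparing it with the surrounding ball, `4√n` times larger, is how
doubling controls the latter by the cell. -/
theorem cellIndex_of_mem_ball (hL : 0 < L) {k : ℕ} {m : Fin n → ℤ} {y : EuclideanSpace ℝ (Fin n)}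
    (hy : y ∈ ball (cellCenter L k m) (L / 2 ^ k)) : cellIndex L k y = m := by
  ext i
  have h1 : |y i - cellCenter L k m i| < L / 2 ^ k := by
    refine lt_of_le_of_lt ?_ hy
    rw [dist_eq_norm, ← Real.norm_eq_abs]
    exact PiLp.norm_apply_le (y - cellCenter L k m) i
  simp only [cellCenter] at h1
  rw [cellIndex, Int.floor_eq_iff]
  have hx : y i = 2 * L * (2 ^ k * (y i + L) / (2 * L)) / 2 ^ k - L := by field_simp; ring
  set u := 2 ^ k * (y i + L) / (2 * L)
  rw [hx] at h1
  have : 2 * L * u / 2 ^ k - L - (2 * L * ((m i : ℝ) + 1 / 2) / 2 ^ k - L) =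
      L / 2 ^ k * (2 * (u - m i) - 1) := by ring
  rw [this, abs_mul, abs_of_pos (by positivity : 0 < L / 2 ^ k)] at h1
  have h2 : |2 * (u - m i) - 1| < 1 := (mul_lt_iff_lt_one_right (by positivity)).1 h1
  rw [abs_lt] at h2
  constructor <;> linarith

theorem cellCenter_zero_zero (L : ℝ) : cellCenter L 0 (0 : Fin n → ℤ) = 0 := by
  ext i
  simp [cellCenter]
  ring

theorem cellIndex_zero_of_mem_ball (hL : 0 < L) {y : EuclideanSpace ℝ (Fin n)}
    (hy : y ∈ ball 0 L) : cellIndex L 0 y = 0 :=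
  cellIndex_of_mem_ball hL (by simpa [cellCenter_zero_zero] using hy)

end Grid

/-! ### The good-`λ` inequality -/

section GoodLambda

variable {n : ℕ} {s : ℝ} {Θ : Finset (EuclideanSpace ℝ (Fin n))}
  {f : EuclideanSpace ℝ (Fin n) → ℂ}

theorem ballMean_eq (hs : 0 < s) {F : Type*} [NormedAddCommGroup F]
    (c : EuclideanSpace ℝ (Fin n)) (r : ℝ) (h : EuclideanSpace ℝ (Fin n) → F) :
    ballMean (ENNReal.ofReal s) c r h = ((volume (ball c r))⁻¹) ^ (1 / s) *
      eLpNorm h (ENNReal.ofReal s) (volume.restrict (ball c r)) := by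
  rw [ballMean, eLpNorm_smul_measure_of_ne_zero
    (ENNReal.inv_ne_zero.2 measure_ball_lt_top.ne)]
  simp [ENNReal.toReal_inv, ENNReal.toReal_ofReal hs.le]

/-- Passing to a subball of half the radius increases a mean boundedly. -/
theorem ballMean_le_of_ball_subset (hs : 0 < s) {F : Type*} [NormedAddCommGroup F]
    {c c' : EuclideanSpace ℝ (Fin n)} {r : ℝ} (hr : 0 < r) (hsub : ball c r ⊆ ball c' (2 * r))
    (h : EuclideanSpace ℝ (Fin n) → F) :
    ballMean (ENNReal.ofReal s) c r h ≤
      2 ^ (n / s : ℝ) * ballMean (ENNReal.ofReal s) c' (2 * r) h := by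
  rw [← ENNReal.rpow_le_rpow_iff hs, ENNReal.mul_rpow_of_nonneg _ _ hs.le, ballMean_rpow hs,
    ballMean_rpow hs, ← ENNReal.rpow_mul, div_mul_cancel₀ _ hs.ne', ENNReal.rpow_natCast]
  have hv : volume (ball c' (2 * r)) = 2 ^ n * volume (ball c r) := by
    rw [volume_ball_eq c hr, volume_ball_eq c' (by positivity),
      ENNReal.ofReal_mul (by norm_num), mul_pow, ENNReal.ofReal_ofNat, mul_assoc]
  rw [hv, ENNReal.mul_inv (by simp) (by simp), ← mul_assoc, ← mul_assoc,
    ENNReal.mul_inv_cancel (by simp) (by simp), one_mul]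
  gcongr

theorem isBestApprox_proj (hs : 1 ≤ s) (hf : MemLp f (ENNReal.ofReal s) volume)
    (c : EuclideanSpace ℝ (Fin n)) (r : ℝ) :
    IsBestApprox s Θ c r ((ball c r).indicator f) (proj s Θ c r ((ball c r).indicator f)) :=
  proj_spec hs Θ c r ((hf.indicator measurableSet_ball).restrict _)

/-- A best approximation is at least as good as `0`, so the triangle inequality bounds its norm by
twice that of the truncated function. -/
theorem eLpNorm_proj_le (hs : 1 ≤ s) (hf : MemLp f (ENNReal.ofReal s) volume)
    (c : EuclideanSpace ℝ (Fin n)) {r : ℝ} (hr : 0 < r) :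
    eLpNorm (proj s Θ c r ((ball c r).indicator f)) (ENNReal.ofReal s)
      (volume.restrict (ball c (3 * r))) ≤
    2 * eLpNorm f (ENNReal.ofReal s) (volume.restrict (ball c r)) := by
  obtain ⟨hmem, heq⟩ := isBestApprox_proj (Θ := Θ) hs hf c r
  set P := proj s Θ c r ((ball c r).indicator f)
  set g := (ball c r).indicator f with hg
  have hgm : AEStronglyMeasurable g (volume.restrict (ball c (3 * r))) :=
    (hf.1.indicator measurableSet_ball).restrict
  have hPm : AEStronglyMeasurable P (volume.restrict (ball c (3 * r))) :=
    (continuous_of_mem_expSpan hmem).aestronglyMeasurable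
  have h1 : eLpNorm g (ENNReal.ofReal s) (volume.restrict (ball c (3 * r))) =
      eLpNorm f (ENNReal.ofReal s) (volume.restrict (ball c r)) := by
    rw [hg, eLpNorm_indicator_eq_eLpNorm_restrict measurableSet_ball,
      Measure.restrict_restrict measurableSet_ball,
      Set.inter_eq_self_of_subset_left (ball_subset_ball (by linarith))]
  have h2 : eLpNorm (g - P) (ENNReal.ofReal s) (volume.restrict (ball c (3 * r))) ≤
      eLpNorm g (ENNReal.ofReal s) (volume.restrict (ball c (3 * r))) := by
    rw [heq]
    refine (iInf₂_le 0 (Submodule.zero_mem _)).trans ?_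
    rw [sub_zero]
  have h3 : P = g - (g - P) := by abel
  rw [h3]
  refine (eLpNorm_sub_le hgm (hgm.sub hPm) (by simpa using hs)).trans ?_
  rw [two_mul, ← h1]
  gcongr

theorem ballMean_proj_le (hs : 1 ≤ s) (hf : MemLp f (ENNReal.ofReal s) volume)
    (c : EuclideanSpace ℝ (Fin n)) {r : ℝ} (hr : 0 < r) :
    ballMean (ENNReal.ofReal s) c (3 * r) (proj s Θ c r ((ball c r).indicator f)) ≤
      2 * ballMean (ENNReal.ofReal s) c r f := by
  rw [ballMean_eq (by linarith) c, ballMean_eq (by linarith) c, mul_left_comm]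
  gcongr
  · linarith
  · exact eLpNorm_proj_le hs hf c hr

theorem ballMean_le_of_forall_enorm_le {q : ℝ≥0∞} (hq : q ≠ 0)
    {c : EuclideanSpace ℝ (Fin n)} {r : ℝ} (hr : 0 < r)
    {h : EuclideanSpace ℝ (Fin n) → ℂ} {b : ℝ≥0∞}
    (hb : ∀ x ∈ ball c r, ‖h x‖ₑ ≤ b) : ballMean q c r h ≤ b := by
  have := isProbabilityMeasure_ball c hr
  have hae : ∀ᵐ x ∂((volume (ball c r))⁻¹ • volume.restrict (ball c r)), ‖h x‖ₑ ≤ ‖b‖ₑ :=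
    Measure.ae_smul_measure ((ae_restrict_iff' measurableSet_ball).2
      (Filter.Eventually.of_forall hb)) _
  refine (eLpNorm_mono_enorm_ae hae).trans ?_
  rw [eLpNorm_const _ hq (IsProbabilityMeasure.ne_zero _)]
  simp

theorem ballMean_le_sharpMaximal {c x : EuclideanSpace ℝ (Fin n)} {r : ℝ} (hr : 0 < r)
    (hx : x ∈ ball c r) :
    ballMean (ENNReal.ofReal s) c r (f - proj s Θ c r ((ball c r).indicator f)) ≤
      sharpMaximal s Θ f x :=
  le_iSup_of_le c (le_iSup_of_le r (le_iSup_of_le hr (le_iSup_of_le hx le_rfl)))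

/-- Where the local means of `f` are large, those of `f - proj f` are large, and this happens
on a small set if the sharp function is small somewhere. -/
theorem rpow_mul_volume_le (hs : 1 ≤ s) (hf : MemLp f (ENNReal.ofReal s) volume) {κ : ℝ≥0∞}
    (hκ : ∀ φ ∈ expSpan Θ, ∀ (c : EuclideanSpace ℝ (Fin n)) (r : ℝ), 0 < r → ∀ x ∈ ball c r,
      ‖φ x‖ₑ ≤ κ * ballMean (ENNReal.ofReal s) c (3 * r) φ)
    {c x₀ : EuclideanSpace ℝ (Fin n)} {r : ℝ} (hr : 0 < r) (hx₀ : x₀ ∈ ball c r) {b τ : ℝ≥0∞}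
    (hτ : sharpMaximal s Θ f x₀ ≤ τ) (hfb : κ * (2 * ballMean (ENNReal.ofReal s) c r f) ≤ b)
    (hb : b ≠ ∞) {S : Set (EuclideanSpace ℝ (Fin n))}
    (hS : ∀ x ∈ S, ∃ c' r', 0 < r' ∧ r' ≤ r ∧ x ∈ ball c' r' ∧ ball c' r' ⊆ ball c r ∧
      2 * b ≤ ballMean (ENNReal.ofReal s) c' r' f) :
    b ^ s * volume S ≤ 5 ^ n * (τ ^ s * volume (ball c r)) := by
  have hs0 : 0 < s := by linarith
  have hsharp := (ballMean_le_sharpMaximal (s := s) (Θ := Θ) (f := f) hr hx₀).trans hτ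
  have hmem := (isBestApprox_proj (Θ := Θ) hs hf c r).1
  have hPle : ∀ x ∈ ball c r, ‖proj s Θ c r ((ball c r).indicator f) x‖ₑ ≤ b := fun x hx =>
    (hκ _ hmem c r hr x hx).trans ((mul_le_mul_right (ballMean_proj_le hs hf c hr) _).trans hfb)
  set P := proj s Θ c r ((ball c r).indicator f)
  have hvol : τ ^ s * volume (ball c r) ≥
      ∫⁻ x, (ball c r).indicator (fun x => ‖(f - P) x‖ₑ ^ s) x := by
    rw [lintegral_indicator measurableSet_ball]
    have := ENNReal.rpow_le_rpow hsharp hs0.le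
    rw [ballMean_rpow hs0, ← ENNReal.div_eq_inv_mul, ENNReal.div_le_iff_le_mul
      (Or.inl (measure_ball_pos _ _ hr).ne') (Or.inl measure_ball_lt_top.ne)] at this
    exact this
  refine le_trans ?_ (mul_le_mul_right hvol _)
  -- The weak type bound is applied to `1_B |f - P|^s` at height `b^s`: since `|P| ≤ b` on `B`, a
  -- mean of `f` of at least `2b` leaves at least `b` for `f - P`.
  refine mul_volume_le_of_forall_exists_ball (R := r) fun x hx => ?_
  obtain ⟨c', r', hr', hrr', hxm, hsub, hle⟩ := hS x hx
  refine ⟨c', r', hr', hrr', hxm, ?_⟩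
  have hmean : b ≤ ballMean (ENNReal.ofReal s) c' r' (f - P) := by
    have h1 : ballMean (ENNReal.ofReal s) c' r' f ≤
        ballMean (ENNReal.ofReal s) c' r' (f - P) + ballMean (ENNReal.ofReal s) c' r' P := by
      have hPm := (continuous_of_mem_expSpan hmem).aestronglyMeasurable
        (μ := (volume (ball c' r'))⁻¹ • volume.restrict (ball c' r'))
      have hfm : AEStronglyMeasurable f
          ((volume (ball c' r'))⁻¹ • volume.restrict (ball c' r')) :=
        hf.1.restrict.smul_measure _
      have := eLpNorm_add_le (hfm.sub hPm) hPm (p := ENNReal.ofReal s) (by simpa using hs)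
      rwa [sub_add_cancel] at this
    have h2 : ballMean (ENNReal.ofReal s) c' r' P ≤ b :=
      ballMean_le_of_forall_enorm_le (by simpa using hs0) hr' fun y hy => hPle y (hsub hy)
    have h3 := hle.trans (h1.trans (add_le_add_right h2 _))
    rw [two_mul] at h3
    exact (ENNReal.add_le_add_iff_right hb).1 h3
  have h4 := ENNReal.rpow_le_rpow hmean hs0.le
  rw [ballMean_rpow hs0, ← ENNReal.div_eq_inv_mul, ENNReal.le_div_iff_mul_le
    (Or.inl (measure_ball_pos _ _ hr').ne') (Or.inl measure_ball_lt_top.ne)] at h4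
  refine h4.trans_eq ?_
  refine setLIntegral_congr_fun measurableSet_ball fun y hy => ?_
  simp [hsub hy]

/-- The mean of `f` over the ball around the dyadic cell of generation `k` containing `x`. -/
noncomputable def cellMean (s L : ℝ) (f : EuclideanSpace ℝ (Fin n) → ℂ) (k : ℕ)
    (x : EuclideanSpace ℝ (Fin n)) : ℝ≥0∞ :=
  ballMean (ENNReal.ofReal s) (cellCenter L k (cellIndex L k x)) (cellRadius n L k) f

theorem cellMean_congr {L : ℝ} {k : ℕ} {x y : EuclideanSpace ℝ (Fin n)}
    (h : cellIndex L k x = cellIndex L k y) : cellMean s L f k x = cellMean s L f k y := by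
  rw [cellMean, cellMean, h]

theorem cellMean_succ_le (hn : 1 ≤ n) (hs : 0 < s) {L : ℝ} (hL : 0 < L) (k : ℕ)
    (x : EuclideanSpace ℝ (Fin n)) :
    cellMean s L f (k + 1) x ≤ 2 ^ (n / s : ℝ) * cellMean s L f k x := by
  have h := ball_cellCenter_succ_subset hL k x
  unfold cellMean
  rw [cellRadius_succ n L k] at h ⊢
  exact ballMean_le_of_ball_subset hs (cellRadius_pos hn hL _) h f

/-- The points of the top cell where the dyadic maximal function exceeds `a`. -/
def superlevel (s L : ℝ) (f : EuclideanSpace ℝ (Fin n) → ℂ) (a : ℝ≥0∞) :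
    Set (EuclideanSpace ℝ (Fin n)) :=
  {x | cellIndex L 0 x = 0 ∧ ∃ k, a < cellMean s L f k x}

/-- The part of a superlevel set where the stopping generation is `k` and the cell is `m`. -/
def stoppingCell (s L : ℝ) (f : EuclideanSpace ℝ (Fin n) → ℂ) (a : ℝ≥0∞)
    (i : ℕ × (Fin n → ℤ)) : Set (EuclideanSpace ℝ (Fin n)) :=
  {x | cellIndex L 0 x = 0 ∧ cellIndex L i.1 x = i.2 ∧ a < cellMean s L f i.1 x ∧
    ∀ j < i.1, cellMean s L f j x ≤ a}

theorem iUnion_stoppingCell (s L : ℝ) (f : EuclideanSpace ℝ (Fin n) → ℂ) (a : ℝ≥0∞) :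
    ⋃ i, stoppingCell s L f a i = superlevel s L f a := by
  classical
  ext x
  simp only [Set.mem_iUnion]
  constructor
  · rintro ⟨i, h0, -, h, -⟩
    exact ⟨h0, _, h⟩
  · rintro ⟨h0, h⟩
    exact ⟨(Nat.find h, cellIndex L (Nat.find h) x), h0, rfl, Nat.find_spec h,
      fun j hj => not_lt.1 (Nat.find_min h hj)⟩

theorem pairwise_disjoint_stoppingCell (s L : ℝ) (f : EuclideanSpace ℝ (Fin n) → ℂ) (a : ℝ≥0∞) :
    Pairwise (Function.onFun Disjoint (stoppingCell s L f a)) := by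
  intro i j hij
  rw [Function.onFun, Set.disjoint_left]
  rintro x ⟨-, hi, hi', hi''⟩ ⟨-, hj, hj', hj''⟩
  have h : i.1 = j.1 := by
    rcases lt_trichotomy i.1 j.1 with h | h | h
    · exact absurd (hj'' _ h) (not_le.2 hi')
    · exact h
    · exact absurd (hi'' _ h) (not_le.2 hj')
  exact hij (Prod.ext h (by rw [← hi, ← hj, h]))

/-- The stopping conditions depend only on the cells of generation at most `i.1`, hence are shared
by the whole cell. -/
theorem stoppingCell_eq {L : ℝ} {a : ℝ≥0∞} {i : ℕ × (Fin n → ℤ)} {x : EuclideanSpace ℝ (Fin n)}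
    (hx : x ∈ stoppingCell s L f a i) :
    stoppingCell s L f a i = {y | cellIndex L i.1 y = i.2} := by
  obtain ⟨h0, h1, h2, h3⟩ := hx
  ext y
  constructor
  · exact fun h => h.2.1
  · intro hy
    have hxy : cellIndex L i.1 y = cellIndex L i.1 x := Eq.trans hy h1.symm
    refine ⟨(cellIndex_congr_of_le (Nat.zero_le _) hxy).trans h0, hy, ?_, fun j hj => ?_⟩
    · rwa [cellMean_congr hxy]
    · rw [cellMean_congr (cellIndex_congr_of_le hj.le hxy)]
      exact h3 j hj

theorem measurableSet_stoppingCell (s L : ℝ) (f : EuclideanSpace ℝ (Fin n) → ℂ) (a : ℝ≥0∞)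
    (i : ℕ × (Fin n → ℤ)) : MeasurableSet (stoppingCell s L f a i) := by
  rcases (stoppingCell s L f a i).eq_empty_or_nonempty with h | ⟨x, hx⟩
  · rw [h]
    exact MeasurableSet.empty
  · rw [stoppingCell_eq hx]
    exact measurable_cellIndex L i.1 (measurableSet_singleton _)

/-- The local good-`λ` estimate: the parent of a stopping cell bounds its mean, `rpow_mul_volume_le`
bounds the bad set in volume, and the reverse Hölder and doubling properties convert this to the
weight of the cell. -/
theorem weightMeasure_inter_stoppingCell_le (hn : 1 ≤ n) (hs : 1 ≤ s)
    (hf : MemLp f (ENNReal.ofReal s) volume) {κ : ℝ≥0∞}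
    (hκ : ∀ φ ∈ expSpan Θ, ∀ (c : EuclideanSpace ℝ (Fin n)) (r : ℝ), 0 < r → ∀ x ∈ ball c r,
      ‖φ x‖ₑ ≤ κ * ballMean (ENNReal.ofReal s) c (3 * r) φ)
    {t : ℝ} (ht : 1 ≤ t) {A D : ℝ≥0} {ω : EuclideanSpace ℝ (Fin n) → ℝ}
    (hω : ReverseHolder (ENNReal.conjExponent (ENNReal.ofReal t)) A ω)
    (hD : ∀ (c : EuclideanSpace ℝ (Fin n)) (r : ℝ), 0 < r →
      weightMeasure ω (ball c (4 * √n * r)) ≤ D * weightMeasure ω (ball c r))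
    {L : ℝ} (hL : 0 < L) {a b τ : ℝ≥0∞}
    (ha : ballMean (ENNReal.ofReal s) 0 (cellRadius n L 0) f ≤ a)
    (hab : κ * (2 * (2 ^ (n / s : ℝ) * a)) ≤ b) (hb0 : b ≠ 0) (hb : b ≠ ∞)
    (hab' : a ≤ 2 * b) (i : ℕ × (Fin n → ℤ)) :
    weightMeasure ω ((superlevel s L f (2 * b) ∩ {x | sharpMaximal s Θ f x ≤ τ}) ∩
        stoppingCell s L f a i) ≤
      A * (5 ^ n * (τ / b) ^ s) ^ (1 / t) * D * weightMeasure ω (stoppingCell s L f a i) := by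
  have hs0 : 0 < s := by linarith
  have ht0 : 0 < t := by linarith
  rcases ((superlevel s L f (2 * b) ∩ {x | sharpMaximal s Θ f x ≤ τ}) ∩
        stoppingCell s L f a i).eq_empty_or_nonempty with h | ⟨x₀, ⟨-, hx₀⟩, hxi⟩
  · rw [h, measure_empty]
    exact zero_le
  rw [stoppingCell_eq hxi]
  obtain ⟨h0, h1, h2, h3⟩ := hxi
  obtain ⟨k, m⟩ := i
  simp only at h1 h2 h3 ⊢
  have hrad := cellRadius_pos hn hL k
  -- The top mean does not exceed `a`, so a stopping cell has a parent.
  have hk : k ≠ 0 := by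
    rintro rfl
    rw [cellMean, h0, cellCenter_zero_zero] at h2
    exact absurd ha (not_le.2 h2)
  have hmean : cellMean s L f k x₀ ≤ 2 ^ (n / s : ℝ) * a := by
    obtain ⟨j, rfl⟩ := Nat.exists_eq_succ_of_ne_zero hk
    refine (cellMean_succ_le hn hs0 hL j x₀).trans ?_
    gcongr
    exact h3 j (Nat.lt_succ_self j)
  have hx₀b := mem_ball_cellCenter hn hL k x₀
  rw [h1] at hx₀b
  rw [cellMean, h1] at hmean
  set S := (superlevel s L f (2 * b) ∩ {x | sharpMaximal s Θ f x ≤ τ}) ∩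
    {y | cellIndex L k y = m}
  have hSsub : S ⊆ ball (cellCenter L k m) (cellRadius n L k) := by
    rintro y ⟨-, hy⟩
    have := mem_ball_cellCenter hn hL k y
    rwa [show cellIndex L k y = m from hy] at this
  have hvol : b ^ s * volume S ≤
      5 ^ n * (τ ^ s * volume (ball (cellCenter L k m) (cellRadius n L k))) := by
    refine rpow_mul_volume_le hs hf hκ hrad hx₀b hx₀
      ((mul_le_mul_right (mul_le_mul_right hmean _) _).trans hab) hb ?_
    rintro y ⟨⟨⟨hy0, j, hj⟩, -⟩, hy⟩
    have hy' : cellIndex L k y = m := hy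
    -- Ancestors of the stopping cell have mean at most `a ≤ 2b`, so a mean above `2b` can only
    -- occur inside it.
    have hkj : k ≤ j := by
      by_contra hlt
      have hlt := not_le.1 hlt
      have h4 := h3 j hlt
      rw [cellMean_congr (cellIndex_congr_of_le hlt.le (h1.trans hy'.symm))] at h4
      exact absurd (h4.trans hab') (not_le.2 hj)
    have hsub := ball_cellCenter_subset_of_le hL hkj y
    rw [hy'] at hsub
    refine ⟨_, _, cellRadius_pos hn hL j, cellRadius_le_of_le hn hL hkj,
      mem_ball_cellCenter hn hL j y, hsub, hj.le⟩
  have hv0 := (measure_ball_pos volume (cellCenter L k m) hrad).ne'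
  have hvt : volume (ball (cellCenter L k m) (cellRadius n L k)) ≠ ∞ := measure_ball_lt_top.ne
  have hratio : volume S / volume (ball (cellCenter L k m) (cellRadius n L k)) ≤
      5 ^ n * (τ / b) ^ s := by
    have hbs0 : b ^ s ≠ 0 := (ENNReal.rpow_pos (pos_iff_ne_zero.2 hb0) hb).ne'
    have hbst : b ^ s ≠ ∞ := ENNReal.rpow_ne_top_of_nonneg hs0.le hb
    rw [ENNReal.div_le_iff hv0 hvt, ENNReal.div_rpow_of_nonneg _ _ hs0.le]
    rw [mul_comm, ← ENNReal.le_div_iff_mul_le (Or.inl hbs0) (Or.inl hbst)] at hvol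
    refine hvol.trans_eq ?_
    simp only [div_eq_mul_inv]
    ring
  refine (hω.weightMeasure_le ht hrad hSsub).trans ?_
  have hWD : weightMeasure ω (ball (cellCenter L k m) (cellRadius n L k)) ≤
      D * weightMeasure ω {y | cellIndex L k y = m} := by
    have h := hD (cellCenter L k m) (L / 2 ^ k) (by positivity)
    have hr : 4 * √(n : ℝ) * (L / 2 ^ k) = cellRadius n L k := by
      unfold cellRadius; ring
    rw [hr] at h
    refine h.trans ?_
    gcongr
    exact fun y hy => cellIndex_of_mem_ball hL hy
  rw [mul_assoc _ (D : ℝ≥0∞)]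
  gcongr

/-- The good-`λ` inequality. -/
theorem weightMeasure_superlevel_inter_le (hn : 1 ≤ n) (hs : 1 ≤ s)
    (hf : MemLp f (ENNReal.ofReal s) volume) {κ : ℝ≥0∞}
    (hκ : ∀ φ ∈ expSpan Θ, ∀ (c : EuclideanSpace ℝ (Fin n)) (r : ℝ), 0 < r → ∀ x ∈ ball c r,
      ‖φ x‖ₑ ≤ κ * ballMean (ENNReal.ofReal s) c (3 * r) φ)
    {t : ℝ} (ht : 1 ≤ t) {A D : ℝ≥0} {ω : EuclideanSpace ℝ (Fin n) → ℝ}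
    (hω : ReverseHolder (ENNReal.conjExponent (ENNReal.ofReal t)) A ω)
    (hD : ∀ (c : EuclideanSpace ℝ (Fin n)) (r : ℝ), 0 < r →
      weightMeasure ω (ball c (4 * √n * r)) ≤ D * weightMeasure ω (ball c r))
    {L : ℝ} (hL : 0 < L) {a b τ : ℝ≥0∞}
    (ha : ballMean (ENNReal.ofReal s) 0 (cellRadius n L 0) f ≤ a)
    (hab : κ * (2 * (2 ^ (n / s : ℝ) * a)) ≤ b) (hb0 : b ≠ 0) (hb : b ≠ ∞)
    (hab' : a ≤ 2 * b) :
    weightMeasure ω (superlevel s L f (2 * b) ∩ {x | sharpMaximal s Θ f x ≤ τ}) ≤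
      A * (5 ^ n * (τ / b) ^ s) ^ (1 / t) * D * weightMeasure ω (superlevel s L f a) := by
  have hsub : superlevel s L f (2 * b) ∩ {x | sharpMaximal s Θ f x ≤ τ} ⊆
      ⋃ i, (superlevel s L f (2 * b) ∩ {x | sharpMaximal s Θ f x ≤ τ}) ∩
        stoppingCell s L f a i := by
    rw [← Set.inter_iUnion, iUnion_stoppingCell]
    rintro x ⟨⟨h0, k, hk⟩, hx⟩
    exact ⟨⟨⟨h0, k, hk⟩, hx⟩, h0, k, hab'.trans_lt hk⟩
  refine (measure_mono hsub).trans ((measure_iUnion_le _).trans ?_)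
  rw [← iUnion_stoppingCell s L f a, measure_iUnion (pairwise_disjoint_stoppingCell s L f a)
    (measurableSet_stoppingCell s L f a), ← ENNReal.tsum_mul_left]
  exact ENNReal.tsum_le_tsum fun i =>
    weightMeasure_inter_stoppingCell_le hn hs hf hκ ht hω hD hL ha hab hb0 hb hab' i

end GoodLambda

/-! ### Large balls and Lebesgue differentiation -/

section Exhaustion

variable {n : ℕ} {s : ℝ} {Θ : Finset (EuclideanSpace ℝ (Fin n))}
  {f : EuclideanSpace ℝ (Fin n) → ℂ}

theorem exists_forall_lt_measure_ball (ν : Measure (EuclideanSpace ℝ (Fin n))) {a : ℝ≥0∞}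
    (h : a < ν Set.univ) : ∃ R₀ : ℝ, ∀ R ≥ R₀, a < ν (ball 0 R) := by
  have hmono : Monotone fun j : ℕ => ball (0 : EuclideanSpace ℝ (Fin n)) j :=
    fun i j hij => ball_subset_ball (by exact_mod_cast hij)
  rw [← iUnion_ball_nat (0 : EuclideanSpace ℝ (Fin n)), hmono.measure_iUnion, lt_iSup_iff] at h
  obtain ⟨j, hj⟩ := h
  exact ⟨j, fun R hR => hj.trans_le (measure_mono (ball_subset_ball hR))⟩

theorem exists_forall_le_volume_ball (hn : 1 ≤ n) {a : ℝ≥0∞} (ha : a ≠ ∞) :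
    ∃ R₀ : ℝ, ∀ R ≥ R₀, a ≤ volume (ball (0 : EuclideanSpace ℝ (Fin n)) R) := by
  set v := volume (ball (0 : EuclideanSpace ℝ (Fin n)) 1)
  have hv0 : v ≠ 0 := (measure_ball_pos _ _ one_pos).ne'
  have hvt : v ≠ ∞ := measure_ball_lt_top.ne
  refine ⟨max 1 (a / v).toReal, fun R hR => ?_⟩
  have h1 : 1 ≤ R := (le_max_left _ _).trans hR
  rw [volume_ball_eq 0 (by linarith), ← ENNReal.div_le_iff_le_mul (Or.inl hv0) (Or.inl hvt)]
  have h2 : 1 ≤ ENNReal.ofReal R := by simpa using h1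
  refine le_trans ?_ (le_self_pow₀ h2 (by omega))
  rw [← ENNReal.ofReal_toReal (ENNReal.div_lt_top ha hv0).ne]
  exact ENNReal.ofReal_le_ofReal ((le_max_right _ _).trans hR)

/-- The sharp function dominates the means over large balls. -/
theorem exists_forall_ballMean_le_sharpMaximal (hn : 1 ≤ n) (hs : 1 ≤ s)
    (hf : MemLp f (ENNReal.ofReal s) volume) (hf0 : eLpNorm f (ENNReal.ofReal s) volume ≠ 0)
    {κ : ℝ≥0∞} (hκt : κ ≠ ∞)
    (hκ : ∀ φ ∈ expSpan Θ, ∀ (c : EuclideanSpace ℝ (Fin n)) (r : ℝ), 0 < r → ∀ x ∈ ball c r,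
      ‖φ x‖ₑ ≤ κ * ballMean (ENNReal.ofReal s) c (3 * r) φ) :
    ∃ R₀ : ℝ, ∀ r ≥ R₀, 0 < r ∧ ballMean (ENNReal.ofReal s) 0 r f ≠ 0 ∧
      ∀ x ∈ ball (0 : EuclideanSpace ℝ (Fin n)) r,
        ballMean (ENNReal.ofReal s) 0 r f ≤ 2 * sharpMaximal s Θ f x := by
  have hs0 : 0 < s := by linarith
  have hs0' : ENNReal.ofReal s ≠ 0 := by simpa using hs0
  have hnorm : ∀ S : Set (EuclideanSpace ℝ (Fin n)), MeasurableSet S →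
      eLpNorm f (ENNReal.ofReal s) (volume.restrict S) =
        (volume.withDensity (fun x => ‖f x‖ₑ ^ s) S) ^ (1 / s) := by
    intro S hS
    rw [withDensity_apply _ hS, eLpNorm_eq_lintegral_rpow_enorm_toReal hs0' ENNReal.ofReal_ne_top,
      ENNReal.toReal_ofReal hs0.le]
  set F := eLpNorm f (ENNReal.ofReal s) volume with hF
  have hFt : F ≠ ∞ := hf.2.ne
  set ν := volume.withDensity (fun x => ‖f x‖ₑ ^ s) with hν
  have hFν : F = ν Set.univ ^ (1 / s) := by
    rw [← hnorm _ MeasurableSet.univ, Measure.restrict_univ]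
  have hlt : (3 / 4 * F) ^ s < ν Set.univ := by
    have h1 : 3 / 4 * F < F := by
      have h2 : (3 / 4 : ℝ≥0∞) < 1 := by
        rw [ENNReal.div_lt_iff (by simp) (by simp)]
        norm_num
      simpa using (ENNReal.mul_lt_mul_iff_left hf0 hFt).2 h2
    have h2 := ENNReal.rpow_lt_rpow h1 hs0
    have h3 : F ^ s = ν Set.univ := by
      rw [hFν, ← ENNReal.rpow_mul, one_div_mul_cancel hs0.ne', ENNReal.rpow_one]
    rwa [h3] at h2
  obtain ⟨ρ, hρ⟩ := exists_forall_lt_measure_ball ν hlt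
  have hρF : 3 / 4 * F ≤ eLpNorm f (ENNReal.ofReal s) (volume.restrict (ball 0 ρ)) := by
    rw [hnorm _ measurableSet_ball, one_div, ENNReal.le_rpow_inv_iff hs0]
    exact (hρ ρ le_rfl).le
  set V := volume (ball (0 : EuclideanSpace ℝ (Fin n)) ρ) with hV
  have hVt : V ≠ ∞ := measure_ball_lt_top.ne
  -- `B(0, ρ)` holds three quarters of the norm `F`. On a ball of this volume the approximation
  -- satisfies `|P| ≤ 2κF |B|^{-1/s}`, so its norm on `B(0, ρ)` is at most `F / 4`, and `f - P`
  -- keeps at least `F / 2`.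
  obtain ⟨R₁, hR₁⟩ := exists_forall_le_volume_ball hn (a := V * (8 * κ) ^ s)
    (ENNReal.mul_ne_top hVt (ENNReal.rpow_ne_top_of_nonneg hs0.le
      (ENNReal.mul_ne_top (by simp) hκt)))
  refine ⟨max 1 (max ρ R₁), fun r hr => ?_⟩
  have hr1 : 1 ≤ r := (le_max_left _ _).trans hr
  have hrρ : ρ ≤ r := (le_max_left _ _).trans ((le_max_right _ _).trans hr)
  have hrR : R₁ ≤ r := (le_max_right _ _).trans ((le_max_right _ _).trans hr)
  have hr0 : 0 < r := by linarith
  have hv0 := (measure_ball_pos volume (0 : EuclideanSpace ℝ (Fin n)) hr0).ne'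
  have hvt : volume (ball (0 : EuclideanSpace ℝ (Fin n)) r) ≠ ∞ := measure_ball_lt_top.ne
  have hres : volume.restrict (ball (0 : EuclideanSpace ℝ (Fin n)) ρ) ≤
      volume.restrict (ball 0 r) := Measure.restrict_mono (ball_subset_ball hrρ) le_rfl
  set u := ((volume (ball (0 : EuclideanSpace ℝ (Fin n)) r))⁻¹) ^ (1 / s) with hu
  have hu0 : u ≠ 0 := (ENNReal.rpow_pos (by simpa [pos_iff_ne_zero] using hvt)
    (by simpa using hv0)).ne'
  have hfr : ballMean (ENNReal.ofReal s) 0 r f ≤ u * F := by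
    rw [ballMean_eq hs0]
    exact mul_le_mul_right (eLpNorm_mono_measure _ Measure.restrict_le_self) _
  refine ⟨hr0, ?_, fun x hx => ?_⟩
  · rw [ballMean_eq hs0]
    refine mul_ne_zero hu0 ?_
    have h1 : 3 / 4 * F ≤ eLpNorm f (ENNReal.ofReal s) (volume.restrict (ball 0 r)) :=
      hρF.trans (eLpNorm_mono_measure _ hres)
    have h2 : 3 / 4 * F ≠ 0 := mul_ne_zero (by simp) hf0
    exact ((pos_iff_ne_zero.2 h2).trans_le h1).ne'
  · refine le_trans ?_ (mul_le_mul_right (ballMean_le_sharpMaximal hr0 hx) _)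
    have hmem := (isBestApprox_proj (Θ := Θ) hs hf 0 r).1
    have hPle : ∀ x ∈ ball 0 r, ‖proj s Θ 0 r ((ball 0 r).indicator f) x‖ₑ ≤
        κ * (2 * (u * F)) := fun x hx =>
      (hκ _ hmem 0 r hr0 x hx).trans
        (mul_le_mul_right ((ballMean_proj_le hs hf 0 hr0).trans (mul_le_mul_right hfr _)) _)
    set P := proj s Θ 0 r ((ball 0 r).indicator f)
    have hPm := (continuous_of_mem_expSpan hmem).aestronglyMeasurable
      (μ := volume.restrict (ball 0 ρ))
    have hPρ : eLpNorm P (ENNReal.ofReal s) (volume.restrict (ball 0 ρ)) ≤ F / 4 := by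
      have hae : ∀ᵐ x ∂(volume.restrict (ball 0 ρ)), ‖P x‖ₑ ≤ ‖κ * (2 * (u * F))‖ₑ :=
        (ae_restrict_iff' measurableSet_ball).2
          (Filter.Eventually.of_forall fun x hx => hPle x (ball_subset_ball hrρ hx))
      refine (eLpNorm_mono_enorm_ae hae).trans ?_
      rw [eLpNorm_const' _ hs0' ENNReal.ofReal_ne_top, ENNReal.toReal_ofReal hs0.le,
        Measure.restrict_apply_univ, ← hV, enorm_eq_self]
      have h1 : V ^ (1 / s) * (8 * κ) * u ≤ 1 := by
        rw [← ENNReal.rpow_le_rpow_iff hs0, ENNReal.mul_rpow_of_nonneg _ _ hs0.le,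
          ENNReal.mul_rpow_of_nonneg _ _ hs0.le, hu, ← ENNReal.rpow_mul, ← ENNReal.rpow_mul,
          one_div_mul_cancel hs0.ne', ENNReal.rpow_one, ENNReal.rpow_one, ENNReal.one_rpow,
          ← div_eq_mul_inv]
        exact ENNReal.div_le_of_le_mul (by simpa using hR₁ r hrR)
      rw [ENNReal.le_div_iff_mul_le (by simp) (by simp)]
      calc κ * (2 * (u * F)) * V ^ (1 / s) * 4 = (V ^ (1 / s) * (8 * κ) * u) * F := by ring
        _ ≤ 1 * F := by gcongr
        _ = F := one_mul F
    have h1 : 3 / 4 * F ≤ eLpNorm (f - P) (ENNReal.ofReal s) (volume.restrict (ball 0 r)) +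
        F / 4 := by
      refine hρF.trans ?_
      have := eLpNorm_add_le (hf.1.restrict.sub hPm) hPm (p := ENNReal.ofReal s) (by simpa using hs)
      rw [sub_add_cancel] at this
      exact this.trans (add_le_add (eLpNorm_mono_measure _ hres) hPρ)
    have h2 : F ≤ 2 * eLpNorm (f - P) (ENNReal.ofReal s) (volume.restrict (ball 0 r)) := by
      have h3 : 3 / 4 * F = F / 2 + F / 4 := by
        rw [← ENNReal.toReal_eq_toReal_iff' (by finiteness) (by finiteness),
          ENNReal.toReal_add (by finiteness) (by finiteness)]
        simp only [ENNReal.toReal_mul, ENNReal.toReal_div, ENNReal.toReal_ofNat]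
        ring
      rw [h3, ENNReal.add_le_add_iff_right (by finiteness)] at h1
      rwa [ENNReal.div_le_iff_le_mul (by simp) (by simp), mul_comm] at h1
    refine hfr.trans ((mul_le_mul_right h2 _).trans_eq ?_)
    rw [ballMean_eq hs0]
    ring

/-- Lebesgue differentiation of `|f|^s` along the cell balls, which contain `x` without being
centered at it and shrink to it. -/
theorem ae_exists_lt_cellMean (hn : 1 ≤ n) (hs : 0 < s)
    (hf : MemLp f (ENNReal.ofReal s) volume) {L : ℝ} (hL : 0 < L) :
    ∀ᵐ x, ∀ a < ‖f x‖ₑ, ∃ k, a < cellMean s L f k x := by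
  have : Nonempty (Fin n) := ⟨⟨0, hn⟩⟩
  have hfin : ∫⁻ x, ‖f x‖ₑ ^ s ≠ ∞ := by
    have := lintegral_rpow_enorm_lt_top_of_eLpNorm_lt_top (by simpa using hs)
      ENNReal.ofReal_ne_top hf.2
    rw [ENNReal.toReal_ofReal hs.le] at this
    exact this.ne
  filter_upwards [(IsUnifLocDoublingMeasure.vitaliFamily (volume :
    Measure (EuclideanSpace ℝ (Fin n))) 1).ae_tendsto_lintegral_div
      (hf.1.enorm.pow_const s) hfin] with x hx a ha
  have hrad : Filter.Tendsto (cellRadius n L) Filter.atTop (nhdsWithin 0 (Set.Ioi 0)) := by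
    rw [tendsto_nhdsWithin_iff]
    refine ⟨?_, Filter.Eventually.of_forall fun k => cellRadius_pos hn hL k⟩
    unfold cellRadius
    exact tendsto_const_nhds.div_atTop (tendsto_pow_atTop_atTop_of_one_lt one_lt_two)
  have hlim := hx.comp (IsUnifLocDoublingMeasure.tendsto_closedBall_filterAt volume (K := 1) (x := x)
    (fun k => cellCenter L k (cellIndex L k x)) (cellRadius n L) hrad
    (Filter.Eventually.of_forall fun k => by
      rw [one_mul]
      exact ball_subset_closedBall (mem_ball_cellCenter hn hL k x)))
  obtain ⟨k, hk⟩ := (hlim.eventually_const_lt (ENNReal.rpow_lt_rpow ha hs)).exists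
  refine ⟨k, ?_⟩
  rw [← ENNReal.rpow_lt_rpow_iff hs, cellMean, ballMean_rpow hs]
  refine hk.trans_eq ?_
  have hae : ball (cellCenter L k (cellIndex L k x)) (cellRadius n L k) =ᵐ[volume]
      closedBall (cellCenter L k (cellIndex L k x)) (cellRadius n L k) :=
    ae_eq_of_subset_of_measure_ge ball_subset_closedBall
      (Measure.addHaar_closedBall_eq_addHaar_ball _ _ _).le
      measurableSet_ball.nullMeasurableSet measure_closedBall_lt_top.ne
  rw [Function.comp_apply, Measure.restrict_congr_set hae, measure_congr hae,
    ENNReal.div_eq_inv_mul]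

end Exhaustion

/-! ### Sums over dyadic levels -/

section LevelSums

theorem sum_range_pow_le {q : ℝ≥0∞} (hq : 2 ≤ q) (l : ℕ) : ∑ j ∈ Finset.range l, q ^ j ≤ q ^ l := by
  induction l with
  | zero => simp
  | succ l ih =>
    rw [Finset.sum_range_succ, pow_succ']
    calc _ ≤ q ^ l + q ^ l := by gcongr
      _ = 2 * q ^ l := (two_mul _).symm
      _ ≤ q * q ^ l := by gcongr

theorem mul_two_pow_rpow (a : ℝ≥0∞) {p : ℝ} (hp : 0 ≤ p) (j : ℕ) :
    (2 ^ j * a) ^ p = (2 ^ p) ^ j * a ^ p := by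
  rw [ENNReal.mul_rpow_of_nonneg _ _ hp]
  congr 1
  rw [← ENNReal.rpow_natCast, ← ENNReal.rpow_natCast, ← ENNReal.rpow_mul, ← ENNReal.rpow_mul,
    mul_comm]

theorem two_le_two_rpow {p : ℝ} (hp : 1 ≤ p) : (2 : ℝ≥0∞) ≤ 2 ^ p := by
  simpa using ENNReal.rpow_le_rpow_of_exponent_le (x := 2) (by norm_num) hp

/-- The terms grow geometrically with ratio `2^p ≥ 2`, so the last level below `h` dominates the
sum. -/
theorem sum_dyadic_le {p : ℝ} (hp : 1 ≤ p) (a h : ℝ≥0∞) (J : ℕ) :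
    ∑ j ∈ Finset.range J, (if 2 ^ j * a < h then (2 ^ j * a) ^ p else 0) ≤ 2 * h ^ p := by
  have hp0 : 0 ≤ p := by linarith
  induction J with
  | zero => simp
  | succ J ih =>
    by_cases hJ : 2 ^ J * a < h
    · calc _ ≤ ∑ j ∈ Finset.range (J + 1), (2 ^ p) ^ j * a ^ p := by
            refine Finset.sum_le_sum fun j _ => ?_
            split_ifs
            · rw [mul_two_pow_rpow a hp0]
            · exact zero_le
        _ = (∑ j ∈ Finset.range J, (2 ^ p) ^ j + (2 ^ p) ^ J) * a ^ p := by
            rw [← Finset.sum_mul, Finset.sum_range_succ]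
        _ ≤ ((2 ^ p) ^ J + (2 ^ p) ^ J) * a ^ p := by
            gcongr
            exact sum_range_pow_le (two_le_two_rpow hp) J
        _ = 2 * (2 ^ J * a) ^ p := by
            rw [mul_two_pow_rpow a hp0]
            ring
        _ ≤ 2 * h ^ p := by gcongr
    · rw [Finset.sum_range_succ, if_neg hJ, add_zero]
      exact ih

theorem rpow_le_add_tsum_dyadic {p : ℝ} (hp : 0 ≤ p) {a h : ℝ≥0∞} (ha : a ≠ 0) (ha' : a ≠ ∞) (hh : h ≠ ∞) :
    h ^ p ≤ a ^ p + 2 ^ p * ∑' j : ℕ, (if 2 ^ j * a < h then (2 ^ j * a) ^ p else 0) := by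
  classical
  have hex : ∃ j : ℕ, h ≤ 2 ^ j * a := by
    obtain ⟨j, hj⟩ := ENNReal.exists_nat_gt (ENNReal.div_lt_top hh ha).ne
    refine ⟨j, ?_⟩
    refine ((ENNReal.div_le_iff ha ha').1 hj.le).trans ?_
    gcongr
    exact_mod_cast Nat.lt_two_pow_self.le
  obtain ⟨hle, hmin⟩ := And.intro (Nat.find_spec hex) fun m => Nat.find_min hex (m := m)
  rcases hj : Nat.find hex with _ | j
  · rw [hj, pow_zero, one_mul] at hle
    exact (ENNReal.rpow_le_rpow hle hp).trans le_self_add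
  · rw [hj] at hle
    have hlt : 2 ^ j * a < h := not_le.1 (hmin j (by omega))
    refine le_trans ?_ le_add_self
    calc h ^ p ≤ (2 * (2 ^ j * a)) ^ p := by
          gcongr
          rwa [← mul_assoc, ← pow_succ']
      _ = 2 ^ p * (if 2 ^ j * a < h then (2 ^ j * a) ^ p else 0) := by
          rw [if_pos hlt, ENNReal.mul_rpow_of_nonneg _ _ hp]
      _ ≤ _ := by
          gcongr
          exact ENNReal.le_tsum (f := fun j : ℕ => if 2 ^ j * a < h then (2 ^ j * a) ^ p else 0) j

end LevelSums

/-! ### Integration of the good-`λ` inequality over the top cell -/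

section Integral

variable {n : ℕ} {s : ℝ} {Θ : Finset (EuclideanSpace ℝ (Fin n))}
  {f : EuclideanSpace ℝ (Fin n) → ℂ}

/-- Absorption of the recursive term in a good-`λ` recursion over dyadic levels. -/
theorem sum_dyadic_le_of_recursion {p : ℝ} (hp : 1 ≤ p) {a ε E₀ : ℝ≥0∞} (ha : a ≠ ∞)
    (hE₀ : E₀ ≠ ∞) {E G : ℕ → ℝ≥0∞} (hE : ∀ j, E j ≤ E₀) {l : ℕ}
    (hrec : ∀ j, E (j + l) ≤ ε * E j + G j) (hε : (2 ^ l) ^ p * ε ≤ 1 / 2) (J : ℕ) :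
    ∑ j ∈ Finset.range J, (2 ^ j * a) ^ p * E j ≤
      2 * ((2 ^ l * a) ^ p * E₀) + 2 * ∑ j ∈ Finset.range J, (2 ^ (j + l) * a) ^ p * G j := by
  have hp0 : 0 ≤ p := by linarith
  set S := ∑ j ∈ Finset.range J, (2 ^ j * a) ^ p * E j with hS
  -- Truncating at `J` levels and bounding `E` by `E₀` make the sum finite, so that `S / 2` can be
  -- subtracted.
  have hSt : S ≠ ∞ := by
    refine (ENNReal.sum_lt_top.2 fun j _ => ENNReal.mul_lt_top ?_ ?_).ne
    · exact ENNReal.rpow_lt_top_of_nonneg hp0 (ENNReal.mul_ne_top (by simp) ha)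
    · exact (hE j).trans_lt hE₀.lt_top
  have h1 : S ≤ (2 ^ l * a) ^ p * E₀ + (S / 2 +
      ∑ j ∈ Finset.range J, (2 ^ (j + l) * a) ^ p * G j) := by
    calc S ≤ ∑ j ∈ Finset.range (l + J), (2 ^ j * a) ^ p * E j :=
          Finset.sum_le_sum_of_subset (Finset.range_subset_range.2 (by omega))
      _ = ∑ j ∈ Finset.range l, (2 ^ j * a) ^ p * E j +
          ∑ j ∈ Finset.range J, (2 ^ (l + j) * a) ^ p * E (l + j) := Finset.sum_range_add _ _ _
      _ ≤ (2 ^ l * a) ^ p * E₀ + ∑ j ∈ Finset.range J,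
          ((2 ^ l) ^ p * ε * ((2 ^ j * a) ^ p * E j) + (2 ^ (j + l) * a) ^ p * G j) := by
          refine add_le_add ?_ (Finset.sum_le_sum fun j _ => ?_)
          · calc _ ≤ ∑ j ∈ Finset.range l, (2 ^ p) ^ j * (a ^ p * E₀) := by
                  refine Finset.sum_le_sum fun j _ => ?_
                  rw [mul_two_pow_rpow a hp0, mul_assoc]
                  gcongr
                  exact hE j
              _ ≤ _ := by
                  rw [← Finset.sum_mul, mul_two_pow_rpow a hp0, mul_assoc]
                  gcongr
                  exact sum_range_pow_le (two_le_two_rpow hp) l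
          · rw [add_comm l j]
            refine (mul_le_mul_right (hrec j) _).trans_eq ?_
            have : (2 ^ (j + l) * a) ^ p = (2 ^ l) ^ p * (2 ^ j * a) ^ p := by
              rw [← ENNReal.mul_rpow_of_nonneg _ _ hp0]
              congr 1
              ring
            rw [this]
            ring
      _ ≤ _ := by
          rw [Finset.sum_add_distrib, ← Finset.mul_sum, ← hS, ENNReal.div_eq_inv_mul, ← one_div]
          gcongr
  have h2 : S / 2 + S / 2 ≤ S / 2 + ((2 ^ l * a) ^ p * E₀ +
      ∑ j ∈ Finset.range J, (2 ^ (j + l) * a) ^ p * G j) := by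
    rw [ENNReal.add_halves]
    exact h1.trans_eq (by ring)
  rw [ENNReal.add_le_add_iff_left (by finiteness), ENNReal.div_le_iff_le_mul (by simp) (by simp)]
    at h2
  exact h2.trans_eq (by ring)

/-- The supremum is uncentered over open balls, so measurability needs no regularity of the choice
of best approximations. -/
theorem isOpen_setOf_lt_sharpMaximal (s : ℝ) (Θ : Finset (EuclideanSpace ℝ (Fin n)))
    (f : EuclideanSpace ℝ (Fin n) → ℂ) (a : ℝ≥0∞) : IsOpen {x | a < sharpMaximal s Θ f x} := by
  have h : {x | a < sharpMaximal s Θ f x} = ⋃ (c) (r) (_ : 0 < r)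
      (_ : a < ballMean (ENNReal.ofReal s) c r (f - proj s Θ c r ((ball c r).indicator f))),
      ball c r := by
    ext x
    simp only [sharpMaximal, lt_iSup_iff, Set.mem_iUnion, Set.mem_ofPred_eq]
    exact exists_congr fun c => exists_congr fun r => exists_congr fun _ =>
      ⟨fun ⟨h1, h2⟩ => ⟨h2, h1⟩, fun ⟨h1, h2⟩ => ⟨h2, h1⟩⟩
  rw [h]
  exact isOpen_iUnion fun c => isOpen_iUnion fun r => isOpen_iUnion fun _ =>
    isOpen_iUnion fun _ => isOpen_ball

theorem measurable_sharpMaximal (s : ℝ) (Θ : Finset (EuclideanSpace ℝ (Fin n)))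
    (f : EuclideanSpace ℝ (Fin n) → ℂ) : Measurable (sharpMaximal s Θ f) :=
  measurable_of_Ioi fun a => (isOpen_setOf_lt_sharpMaximal s Θ f a).measurableSet

theorem measurableSet_superlevel (s L : ℝ) (f : EuclideanSpace ℝ (Fin n) → ℂ) (a : ℝ≥0∞) :
    MeasurableSet (superlevel s L f a) := by
  rw [← iUnion_stoppingCell]
  exact MeasurableSet.iUnion (measurableSet_stoppingCell s L f a)

theorem lintegral_topCell_le (hn : 1 ≤ n) (hs : 1 ≤ s)
    (hf : MemLp f (ENNReal.ofReal s) volume) {κ : ℝ≥0∞}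
    (hκ : ∀ φ ∈ expSpan Θ, ∀ (c : EuclideanSpace ℝ (Fin n)) (r : ℝ), 0 < r → ∀ x ∈ ball c r,
      ‖φ x‖ₑ ≤ κ * ballMean (ENNReal.ofReal s) c (3 * r) φ)
    {t : ℝ} (ht : 1 ≤ t) {A D : ℝ≥0} {ω : EuclideanSpace ℝ (Fin n) → ℝ}
    (hω : ReverseHolder (ENNReal.conjExponent (ENNReal.ofReal t)) A ω)
    (hD : ∀ (c : EuclideanSpace ℝ (Fin n)) (r : ℝ), 0 < r →
      weightMeasure ω (ball c (4 * √n * r)) ≤ D * weightMeasure ω (ball c r))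
    {L : ℝ} (hL : 0 < L) {p : ℝ} (hp : 1 ≤ p) {l : ℕ} (hl : 4 * 2 ^ (n / s : ℝ) * κ ≤ 2 ^ l)
    {Y : ℝ≥0∞} (hlY : 2 ^ l ≤ Y) (hYt : Y ≠ ∞)
    (hε : (2 ^ l) ^ p * (A * (5 ^ n * (2 / Y) ^ s) ^ (1 / t) * D) ≤ 1 / 2)
    (ha0 : ballMean (ENNReal.ofReal s) 0 (cellRadius n L 0) f ≠ 0)
    (hsharp : ∀ x ∈ ball (0 : EuclideanSpace ℝ (Fin n)) (cellRadius n L 0),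
      ballMean (ENNReal.ofReal s) 0 (cellRadius n L 0) f ≤ 2 * sharpMaximal s Θ f x) :
    ∫⁻ x in {x | cellIndex L 0 x = 0}, ‖f x‖ₑ ^ p ∂(weightMeasure ω) ≤
      8 * 4 ^ p * Y ^ p * ∫⁻ x, sharpMaximal s Θ f x ^ p ∂(weightMeasure ω) := by
  have hp0 : 0 ≤ p := by linarith
  have hs0 : 0 < s := by linarith
  have hY1 : 1 ≤ Y := (one_le_pow₀ one_le_two).trans hlY
  have hY0 : Y ≠ 0 := (one_pos.trans_le hY1).ne'
  have hrad := cellRadius_pos hn hL 0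
  set a := ballMean (ENNReal.ofReal s) 0 (cellRadius n L 0) f with ha
  have hat : a ≠ ∞ := by
    rw [ha, ballMean_eq hs0]
    refine ENNReal.mul_ne_top (ENNReal.rpow_ne_top_of_nonneg (by positivity)
      (ENNReal.inv_ne_top.2 (measure_ball_pos _ _ hrad).ne')) (hf.restrict _).2.ne
  set W := weightMeasure ω with hW
  set Q : Set (EuclideanSpace ℝ (Fin n)) := {x | cellIndex L 0 x = 0} with hQ
  have hQm : MeasurableSet Q := measurable_cellIndex L 0 (measurableSet_singleton _)
  have hQsub : Q ⊆ ball 0 (cellRadius n L 0) := by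
    intro x hx
    have := mem_ball_cellCenter hn hL 0 x
    rwa [show cellIndex L 0 x = 0 from hx, cellCenter_zero_zero] at this
  have hWQ : W Q ≠ ∞ :=
    ne_top_of_le_ne_top (hω.isWeight.weightMeasure_ball_ne_top _ _) (measure_mono hQsub)
  set X := ∫⁻ x, sharpMaximal s Θ f x ^ p ∂W with hX
  -- This pays for the levels below `l`, which the recursion does not reach.
  have hX0 : a ^ p * W Q ≤ 2 ^ p * X := by
    rw [← setLIntegral_const, hX, ← lintegral_const_mul' _ _ (by finiteness)]
    refine le_trans (setLIntegral_mono' hQm fun x hx => ?_)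
      (lintegral_mono' Measure.restrict_le_self le_rfl)
    rw [← ENNReal.mul_rpow_of_nonneg _ _ hp0]
    exact ENNReal.rpow_le_rpow (hsharp x (hQsub hx)) hp0
  have hrec : ∀ j, W (superlevel s L f (2 ^ (j + l) * a)) ≤
      A * (5 ^ n * (2 / Y) ^ s) ^ (1 / t) * D * W (superlevel s L f (2 ^ j * a)) +
        W {x | 2 ^ (j + l) * a < Y * sharpMaximal s Θ f x} := by
    intro j
    set z := 2 ^ (j + l) * a with hz
    have hz0 : z ≠ 0 := mul_ne_zero (by simp) ha0
    have hzt : z ≠ ∞ := ENNReal.mul_ne_top (by simp) hat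
    have hz2 : 2 * (z / 2) = z := ENNReal.mul_div_cancel (by simp) (by simp)
    have hz20 : z / 2 ≠ 0 := by simpa using hz0
    have hτ : z / Y / (z / 2) = 2 / Y := by
      rw [← ENNReal.toReal_eq_toReal_iff' (by finiteness) (by finiteness)]
      simp only [ENNReal.toReal_div, ENNReal.toReal_ofNat]
      have : z.toReal ≠ 0 := ENNReal.toReal_ne_zero.2 ⟨hz0, hzt⟩
      have : Y.toReal ≠ 0 := ENNReal.toReal_ne_zero.2 ⟨hY0, hYt⟩
      field_simp
    -- Here `2b = z` is the level `l` steps up, `hl` makes the jump large enough for `κ`, and `τ / b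
    -- = 2 / Y` is independent of `j`.
    have h := weightMeasure_superlevel_inter_le (a := 2 ^ j * a) (b := z / 2) (τ := z / Y)
      hn hs hf hκ ht hω hD hL (le_mul_of_one_le_left zero_le (one_le_pow₀ one_le_two)) (by
        rw [ENNReal.le_div_iff_mul_le (by simp) (by simp)]
        calc κ * (2 * (2 ^ (n / s : ℝ) * (2 ^ j * a))) * 2 =
            4 * 2 ^ (n / s : ℝ) * κ * (2 ^ j * a) := by ring
          _ ≤ 2 ^ l * (2 ^ j * a) := by gcongr
          _ = z := by rw [hz, pow_add]; ring) (by simpa using hz0) (by finiteness) (by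
        rw [hz2, hz]
        gcongr
        · exact one_le_two
        · omega)
    rw [hz2, hτ] at h
    refine le_trans (measure_mono fun x hx => ?_) ((measure_union_le _ _).trans
      (add_le_add_left h _))
    by_cases hxs : sharpMaximal s Θ f x ≤ z / Y
    · exact Or.inl ⟨hx, hxs⟩
    · refine Or.inr ?_
      have := (ENNReal.div_lt_iff (Or.inl hY0) (Or.inl hYt)).1 (not_le.1 hxs)
      rwa [mul_comm] at this
  have hG : ∀ J, ∑ j ∈ Finset.range J, (2 ^ (j + l) * a) ^ p *
      W {x | 2 ^ (j + l) * a < Y * sharpMaximal s Θ f x} ≤ 2 * (Y ^ p * X) := by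
    intro J
    have hmeas : ∀ j : ℕ, MeasurableSet {x | 2 ^ (j + l) * a < Y * sharpMaximal s Θ f x} :=
      fun j => measurableSet_lt measurable_const ((measurable_sharpMaximal s Θ f).const_mul Y)
    calc _ = ∫⁻ x, ∑ j ∈ Finset.range J, {x | 2 ^ (j + l) * a < Y * sharpMaximal s Θ f x}.indicator
          (fun _ => (2 ^ (j + l) * a) ^ p) x ∂W := by
          rw [lintegral_finsetSum _ fun j _ => measurable_const.indicator (hmeas j)]
          simp_rw [lintegral_indicator_const (hmeas _)]
      _ ≤ ∫⁻ x, 2 * (Y ^ p * sharpMaximal s Θ f x ^ p) ∂W := by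
          refine lintegral_mono fun x => ?_
          rw [← ENNReal.mul_rpow_of_nonneg _ _ hp0]
          refine le_trans (Finset.sum_le_sum fun j _ => ?_)
            (sum_dyadic_le hp (2 ^ l * a) (Y * sharpMaximal s Θ f x) J)
          rw [← mul_assoc, ← pow_add, Set.indicator_apply]
          rfl
      _ = 2 * (Y ^ p * X) := by
          rw [lintegral_const_mul' _ _ (by simp), lintegral_const_mul' _ _ (by finiteness)]
  have hS : ∀ J, ∑ j ∈ Finset.range J, (2 ^ j * a) ^ p * W (superlevel s L f (2 ^ j * a)) ≤
      2 * (Y ^ p * (2 ^ p * X)) + 2 * (2 * (Y ^ p * X)) := by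
    intro J
    refine (sum_dyadic_le_of_recursion hp hat hWQ (fun j => measure_mono fun x hx => hx.1)
      hrec hε J).trans ?_
    refine add_le_add (mul_le_mul_right ?_ _) (mul_le_mul_right (hG J) _)
    rw [ENNReal.mul_rpow_of_nonneg _ _ hp0, mul_assoc]
    gcongr
  -- The exceptional Lebesgue-null set is also null for `ω dx`.
  have hpt : ∀ᵐ x ∂(W.restrict Q), ‖f x‖ₑ ^ p ≤ a ^ p + 2 ^ p * ∑' j : ℕ,
      (superlevel s L f (2 ^ j * a)).indicator (fun _ => (2 ^ j * a) ^ p) x := by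
    rw [ae_restrict_iff' hQm]
    filter_upwards [(weightMeasure_absolutelyContinuous ω).ae_le
      (ae_exists_lt_cellMean hn hs0 hf hL)] with x hx hxQ
    refine (rpow_le_add_tsum_dyadic hp0 ha0 hat enorm_ne_top).trans ?_
    gcongr with j
    split_ifs with h
    · rw [Set.indicator_of_mem (show x ∈ superlevel s L f (2 ^ j * a) from ⟨hxQ, hx _ h⟩)]
    · exact zero_le
  calc ∫⁻ x in Q, ‖f x‖ₑ ^ p ∂W ≤ ∫⁻ x in Q, (a ^ p + 2 ^ p * ∑' j : ℕ,
        (superlevel s L f (2 ^ j * a)).indicator (fun _ => (2 ^ j * a) ^ p) x) ∂W :=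
        lintegral_mono_ae hpt
    _ = a ^ p * W Q + 2 ^ p * ∑' j : ℕ,
        (2 ^ j * a) ^ p * W (superlevel s L f (2 ^ j * a)) := by
        rw [lintegral_add_left measurable_const, setLIntegral_const,
          lintegral_const_mul' _ _ (by finiteness), lintegral_tsum fun j =>
            (measurable_const.indicator (measurableSet_superlevel s L f _)).aemeasurable]
        congr 2
        refine tsum_congr fun j => ?_
        rw [lintegral_indicator_const (measurableSet_superlevel s L f _),
          Measure.restrict_apply (measurableSet_superlevel s L f _),
          Set.inter_eq_self_of_subset_left fun x hx => hx.1]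
    _ ≤ 2 ^ p * X + 2 ^ p * (2 * (Y ^ p * (2 ^ p * X)) + 2 * (2 * (Y ^ p * X))) := by
        gcongr
        rw [ENNReal.tsum_eq_iSup_nat]
        exact iSup_le hS
    _ ≤ 8 * 4 ^ p * Y ^ p * X := by
        have h4 : (4 : ℝ≥0∞) ^ p = 2 ^ p * 2 ^ p := by
          rw [← ENNReal.mul_rpow_of_nonneg _ _ hp0]
          norm_num
        have h2 : (1 : ℝ≥0∞) ≤ 2 ^ p := one_le_two.trans (two_le_two_rpow hp)
        have hYp : 1 ≤ Y ^ p := ENNReal.one_le_rpow hY1 (by linarith)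
        rw [h4]
        calc _ = 1 * 2 ^ p * 1 * X + 2 * (2 ^ p * 2 ^ p) * Y ^ p * X +
              4 * (1 * 2 ^ p) * Y ^ p * X := by ring
          _ ≤ 2 * 2 ^ p * 2 ^ p * Y ^ p * X + 2 * (2 ^ p * 2 ^ p) * Y ^ p * X +
              4 * (2 ^ p * 2 ^ p) * Y ^ p * X := by
              gcongr
              exact one_le_two.trans (le_mul_of_one_le_right zero_le h2)
          _ = _ := by ring

end Integral

/-! ### Exhaustion of space and the choice of parameters -/

section Final

variable {n : ℕ} {s : ℝ} {Θ : Finset (EuclideanSpace ℝ (Fin n))}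
  {f : EuclideanSpace ℝ (Fin n) → ℂ}

theorem lintegral_rpow_enorm_le (hn : 1 ≤ n) (hs : 1 ≤ s)
    (hf : MemLp f (ENNReal.ofReal s) volume) (hf0 : eLpNorm f (ENNReal.ofReal s) volume ≠ 0)
    {κ : ℝ≥0∞} (hκt : κ ≠ ∞)
    (hκ : ∀ φ ∈ expSpan Θ, ∀ (c : EuclideanSpace ℝ (Fin n)) (r : ℝ), 0 < r → ∀ x ∈ ball c r,
      ‖φ x‖ₑ ≤ κ * ballMean (ENNReal.ofReal s) c (3 * r) φ)
    {t : ℝ} (ht : 1 ≤ t) {A D : ℝ≥0} {ω : EuclideanSpace ℝ (Fin n) → ℝ}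
    (hω : ReverseHolder (ENNReal.conjExponent (ENNReal.ofReal t)) A ω)
    (hD : ∀ (c : EuclideanSpace ℝ (Fin n)) (r : ℝ), 0 < r →
      weightMeasure ω (ball c (4 * √n * r)) ≤ D * weightMeasure ω (ball c r))
    {p : ℝ} (hp : 1 ≤ p) {l : ℕ} (hl : 4 * 2 ^ (n / s : ℝ) * κ ≤ 2 ^ l)
    {Y : ℝ≥0∞} (hlY : 2 ^ l ≤ Y) (hYt : Y ≠ ∞)
    (hε : (2 ^ l) ^ p * (A * (5 ^ n * (2 / Y) ^ s) ^ (1 / t) * D) ≤ 1 / 2) :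
    ∫⁻ x, ‖f x‖ₑ ^ p ∂(weightMeasure ω) ≤
      8 * 4 ^ p * Y ^ p * ∫⁻ x, sharpMaximal s Θ f x ^ p ∂(weightMeasure ω) := by
  -- The bound on the top cell does not depend on `L`. If it failed globally, a large enough ball
  -- inside the cell would already violate it, even when the left-hand side is infinite.
  by_contra! hlt
  rw [← setLIntegral_univ fun x => ‖f x‖ₑ ^ p, ← withDensity_apply _ MeasurableSet.univ] at hlt
  obtain ⟨R₁, hR₁⟩ := exists_forall_lt_measure_ball _ hlt
  obtain ⟨R₀, hR₀⟩ := exists_forall_ballMean_le_sharpMaximal hn hs hf hf0 hκt hκ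
  set L := max 1 (max R₀ R₁)
  have hL : 0 < L := one_pos.trans_le (le_max_left _ _)
  have hrad : R₀ ≤ cellRadius n L 0 := by
    have h1 : R₀ ≤ L := (le_max_left _ _).trans (le_max_right _ _)
    have h2 : 1 ≤ √(n : ℝ) := Real.one_le_sqrt.2 (by exact_mod_cast hn)
    unfold cellRadius
    rw [pow_zero, div_one]
    nlinarith
  obtain ⟨-, ha0, hsharp⟩ := hR₀ _ hrad
  have h := hR₁ L ((le_max_right _ _).trans (le_max_right _ _))
  rw [withDensity_apply _ measurableSet_ball] at h
  refine absurd h (not_lt.2 (le_trans ?_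
    (lintegral_topCell_le hn hs hf hκ ht hω hD hL hp hl hlY hYt hε ha0 hsharp)))
  exact lintegral_mono_set fun x hx => cellIndex_zero_of_mem_ball hL hx

/-- Parameters making the good-`λ` inequality absorbable, at the cost of a power of the
Nikolskii constant. -/
theorem exists_absorbing_parameters {t p : ℝ} (hs : 0 < s) (ht : 1 ≤ t) (hp : s ≤ p) (A D : ℝ≥0)
    (n : ℕ) (B : ℝ≥0) :
    ∃ C : ℝ≥0, ∀ m : ℝ≥0∞, 1 ≤ m → m ≠ ∞ → ∃ (l : ℕ) (Y : ℝ≥0∞),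
      B * m ≤ 2 ^ l ∧ 2 ^ l ≤ Y ∧ Y ≠ ∞ ∧
      (2 ^ l) ^ p * (A * (5 ^ n * (2 / Y) ^ s) ^ (1 / t) * D) ≤ 1 / 2 ∧
      Y ≤ C * m ^ (t * p / s) := by
  have ht0 : 0 < t := by linarith
  have hp0 : 0 < p := by linarith
  -- With this `β` the smallness condition reads `(2^l)^p β ≤ Y^{s/t}`, which forces `Y` to be of
  -- order `(2^l)^{tp/s}`; the maximum with `1` in `C₃` serves `2^l ≤ Y`.
  set β : ℝ≥0∞ := 2 * A * D * (5 ^ n * 2 ^ s) ^ (1 / t) with hβ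
  have hβt : β ≠ ∞ := by
    have h2 : (2 : ℝ≥0∞) ^ s ≠ ∞ := ENNReal.rpow_ne_top_of_nonneg hs.le (by simp)
    exact ENNReal.mul_ne_top (by finiteness) (ENNReal.rpow_ne_top_of_nonneg (by positivity)
      (by finiteness))
  set C₃ : ℝ≥0∞ := max 1 (β ^ (t / s)) with hC₃
  have hC₃t : C₃ ≠ ∞ := by
    have : β ^ (t / s) ≠ ∞ := ENNReal.rpow_ne_top_of_nonneg (by positivity) hβt
    exact (max_lt ENNReal.one_lt_top this.lt_top).ne
  set K : ℝ≥0∞ := max 1 B with hK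
  have hKt : K ≠ ∞ := (max_lt ENNReal.one_lt_top ENNReal.coe_lt_top).ne
  have hE0 : 0 ≤ t * p / s := by positivity
  have hE1 : 1 ≤ t * p / s := by
    rw [le_div_iff₀ hs]
    nlinarith
  have hCt : C₃ * (2 * K) ^ (t * p / s) ≠ ∞ :=
    ENNReal.mul_ne_top hC₃t (ENNReal.rpow_ne_top_of_nonneg hE0 (by finiteness))
  refine ⟨(C₃ * (2 * K) ^ (t * p / s)).toNNReal, fun m hm hmt => ?_⟩
  -- The least admissible `l` overshoots by at most a factor `2`, so `Y` stays comparable to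
  -- `m^{tp/s}`.
  have hl : ∃ l : ℕ, K * m ≤ 2 ^ l ∧ 2 ^ l ≤ 2 * (K * m) := by
    classical
    have hex : ∃ l : ℕ, K * m ≤ 2 ^ l := by
      obtain ⟨j, hj⟩ := ENNReal.exists_nat_gt (ENNReal.mul_ne_top hKt hmt)
      exact ⟨j, hj.le.trans (by exact_mod_cast Nat.lt_two_pow_self.le)⟩
    refine ⟨Nat.find hex, Nat.find_spec hex, ?_⟩
    rcases hj : Nat.find hex with _ | j
    · have : 1 ≤ K * m := one_le_mul (le_max_left _ _) hm
      rw [pow_zero]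
      exact this.trans (le_mul_of_one_le_left zero_le one_le_two)
    · rw [pow_succ']
      gcongr
      exact (not_le.1 (Nat.find_min hex (m := j) (by omega))).le
  obtain ⟨l, hl1, hl2⟩ := hl
  have h2l : (1 : ℝ≥0∞) ≤ 2 ^ l := one_le_pow₀ one_le_two
  set Y : ℝ≥0∞ := C₃ * (2 ^ l) ^ (t * p / s) with hY
  have hYt : Y ≠ ∞ :=
    ENNReal.mul_ne_top hC₃t (ENNReal.rpow_ne_top_of_nonneg hE0 (by simp))
  have hlY : 2 ^ l ≤ Y := by
    calc (2 : ℝ≥0∞) ^ l = 1 * (2 ^ l) ^ (1 : ℝ) := by rw [ENNReal.rpow_one, one_mul]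
      _ ≤ Y := by
        rw [hY]
        gcongr
        · exact le_max_left _ _
  have hY0 : Y ≠ 0 := (one_pos.trans_le (h2l.trans hlY)).ne'
  refine ⟨l, Y, le_trans (by gcongr; exact le_max_right _ _) hl1, hlY, hYt, ?_, ?_⟩
  · have hst : 0 < s / t := by positivity
    have hYst : (2 ^ l) ^ p * β ≤ Y ^ (s / t) := by
      rw [hY, ENNReal.mul_rpow_of_nonneg _ _ hst.le, ← ENNReal.rpow_mul, mul_comm]
      have h1 : t * p / s * (s / t) = p := by field_simp
      have h2 : β = (β ^ (t / s)) ^ (s / t) := by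
        rw [← ENNReal.rpow_mul]
        have : t / s * (s / t) = 1 := by field_simp
        rw [this, ENNReal.rpow_one]
      rw [h1]
      gcongr
      rw [h2]
      gcongr
      exact le_max_right _ _
    have hYs0 : Y ^ (s / t) ≠ 0 := (ENNReal.rpow_pos (pos_iff_ne_zero.2 hY0) hYt).ne'
    have hYst' : Y ^ (s / t) ≠ ∞ := ENNReal.rpow_ne_top_of_nonneg hst.le hYt
    have hpow : (5 ^ n * (2 / Y) ^ s) ^ (1 / t) = (5 ^ n * 2 ^ s) ^ (1 / t) * (Y ^ (s / t))⁻¹ := by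
      rw [ENNReal.div_rpow_of_nonneg _ _ hs.le, div_eq_mul_inv, ← mul_assoc,
        ENNReal.mul_rpow_of_nonneg _ _ (by positivity), ENNReal.inv_rpow, ← ENNReal.rpow_mul,
        mul_one_div]
    have h2 : (2 : ℝ≥0∞)⁻¹ * 2 = 1 := ENNReal.inv_mul_cancel (by simp) (by simp)
    calc (2 ^ l) ^ p * (A * (5 ^ n * (2 / Y) ^ s) ^ (1 / t) * D)
        = 2⁻¹ * 2 * ((2 ^ l) ^ p * (A * (5 ^ n * (2 / Y) ^ s) ^ (1 / t) * D)) := by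
          rw [h2, one_mul]
      _ = 2⁻¹ * ((2 ^ l) ^ p * β * (Y ^ (s / t))⁻¹) := by
          rw [hpow, hβ]
          ring
      _ ≤ 2⁻¹ * (Y ^ (s / t) * (Y ^ (s / t))⁻¹) := by gcongr
      _ = 1 / 2 := by rw [ENNReal.mul_inv_cancel hYs0 hYst', mul_one, one_div]
  · rw [ENNReal.coe_toNNReal hCt, mul_assoc, ← ENNReal.mul_rpow_of_nonneg _ _ hE0, hY]
    gcongr
    rwa [mul_assoc]

end Final

end MultiFreq

theorem proposition2p3 (n : ℕ) (hn : 1 ≤ n) (s t p : ℝ) (hs : 1 < s) (ht : 1 ≤ t) (hp : s ≤ p)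
    (A : ℝ≥0) :
    ∃ C : ℝ≥0, ∀ (ω : EuclideanSpace ℝ (Fin n) → ℝ),
      MultiFreq.ReverseHolder (ENNReal.conjExponent (ENNReal.ofReal t)) A ω →
      ∀ (Θ : Finset (EuclideanSpace ℝ (Fin n))), Θ.Nonempty →
      ∀ (f : EuclideanSpace ℝ (Fin n) → ℂ), MemLp f (ENNReal.ofReal s) volume →
        eLpNorm f (ENNReal.ofReal p) (MultiFreq.weightMeasure ω) ≤
          C * (Θ.card : ℝ≥0∞) ^ (t * p / s * max (1 / 2) (1 / s)) *
            eLpNorm (MultiFreq.sharpMaximal s Θ f) (ENNReal.ofReal p)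
              (MultiFreq.weightMeasure ω) := by
  obtain ⟨C₁, hC₁⟩ := MultiFreq.exists_enorm_le_ballMean n hs.le
  obtain ⟨D, hD⟩ := MultiFreq.exists_doubling_const n ht A (4 * √n)
  have h2n : (2 : ℝ≥0∞) ^ (n / s : ℝ) ≠ ∞ :=
    ENNReal.rpow_ne_top_of_nonneg (by positivity) (by simp)
  have hBt : 4 * 2 ^ (n / s : ℝ) * (C₁ : ℝ≥0∞) ≠ ∞ := by finiteness
  obtain ⟨C₂, hC₂⟩ := MultiFreq.exists_absorbing_parameters (s := s) (by linarith) ht hp A D n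
    (4 * 2 ^ (n / s : ℝ) * (C₁ : ℝ≥0∞)).toNNReal
  have hp0 : 0 < p := by linarith
  have h84 : (8 * 4 ^ p : ℝ≥0∞) ^ (1 / p) ≠ ∞ :=
    ENNReal.rpow_ne_top_of_nonneg (by positivity) (ENNReal.mul_ne_top (by simp)
      (ENNReal.rpow_ne_top_of_nonneg hp0.le (by simp)))
  refine ⟨((8 * 4 ^ p : ℝ≥0∞) ^ (1 / p)).toNNReal * C₂, fun ω hω Θ hΘ f hf => ?_⟩
  by_cases hf0 : eLpNorm f (ENNReal.ofReal s) volume = 0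
  · have h := (eLpNorm_eq_zero_iff hf.1 (by simpa using by linarith)).1 hf0
    rw [eLpNorm_congr_ae ((MultiFreq.weightMeasure_absolutelyContinuous ω).ae_le h), eLpNorm_zero]
    exact zero_le
  set m : ℝ≥0∞ := (Θ.card : ℝ≥0∞) ^ max (1 / 2) (1 / s) with hm
  have hmax : 0 ≤ max (1 / 2) (1 / s) := le_max_of_le_left (by norm_num)
  have hm1 : 1 ≤ m := by
    rw [hm]
    rcases hmax.eq_or_lt with h | h
    · rw [← h, ENNReal.rpow_zero]
    · exact ENNReal.one_le_rpow (by exact_mod_cast hΘ.card_pos) h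
  have hmt : m ≠ ∞ := ENNReal.rpow_ne_top_of_nonneg hmax (by simp)
  obtain ⟨l, Y, hl, hlY, hYt, hε, hY⟩ := hC₂ m hm1 hmt
  rw [ENNReal.coe_toNNReal hBt, mul_assoc] at hl
  have key := MultiFreq.lintegral_rpow_enorm_le hn hs.le hf hf0
    (κ := C₁ * m) (by finiteness) (hC₁ Θ) ht hω (hD ω hω) (p := p) (by linarith) hl hlY hYt hε
  have hp0' : ENNReal.ofReal p ≠ 0 := by simpa using hp0
  rw [eLpNorm_eq_lintegral_rpow_enorm_toReal hp0' ENNReal.ofReal_ne_top,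
    eLpNorm_eq_lintegral_rpow_enorm_toReal hp0' ENNReal.ofReal_ne_top, ENNReal.toReal_ofReal hp0.le]
  simp only [enorm_eq_self]
  have h1p : 0 ≤ 1 / p := by positivity
  refine (ENNReal.rpow_le_rpow key h1p).trans ?_
  -- The `p`-th root turns `Y^p` into `Y ≤ C₂ m^{tp/s}`, and `m` is the frequency factor of the
  -- Nikolskii constant.
  rw [ENNReal.mul_rpow_of_nonneg _ _ h1p, ENNReal.mul_rpow_of_nonneg _ _ h1p, ← ENNReal.rpow_mul Y,
    mul_one_div_cancel hp0.ne', ENNReal.rpow_one, ENNReal.coe_mul, ENNReal.coe_toNNReal h84,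
    mul_comm (t * p / s), ENNReal.rpow_mul, ← hm, mul_assoc _ (C₂ : ℝ≥0∞)]
  gcongr
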